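/- **Conventions.** A *retraction* on a smooth manifold $M$ is a smooth map $\mathrm R:\mathcal D\to M$, $(x,v)\mapsto \mathrm R_x(v)$, on an open neighbourhood $\mathcal D\subseteq TM$ of the zero section, such that for all $(x,v)\in TM$ the curve $s\mapsto \mathrm R_x(sv)$ satisfies $\mathrm R_x(0)=x$ and $\frac{d}{ds}\mathrm R_x(sv)|_{s=0}=v$. ($\mathcal D=TM$ is allowed.) $\mathrm{St}(n,k)=\{X\in\mathbb R^{n\times k}: X^TX=I_k\}$ is the Stiefel manifold. **Setting.** Let $T$ be a dimension tree over $D=\{1,\dots,d\}$, $d\ge 2$: a rooted binary tree whose nodes are subsets of $D$, with root $t_B=D$, with the singletons as leaves, and such that each internal node $t$ (set $J$) is the disjoint union of its children $t_L,t_R$, all elements of $t_L$ being smaller than those of $t_R$. Put $J^-=J\setminus\{t_B\}$ and let $(k_t)_{t\in T}$ be positive integers. A parameter is a family $x=(B_t)_{t\in J}$ of tensors in $\mathbb R^{k_{t_L}\times k_{t_R}\times k_t}$, identified with their $(1,2)$-matricizations $B_t\in\mathbb R^{k_{t_L}k_{t_R}\times k_t}$. It is *full rank* if $B_t$ has rank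 $k_t$ for all $t\in J^-$ and the mode-1 and mode-2 matricizations of $B_t$ have full rank for all $t\in J$ with $|t|\neq 2$. Let $\mathcal T$ be the embedded submanifold of all full-rank parameters with $B_t^TB_t=I_{k_t}$ for all $t\in J^-$. The group $\mathcal G=\prod_{t\in J^-}\mathrm O(k_t)$ acts on it by $\theta(x,A)=\big((A_{t_L}\otimes_K A_{t_R})^TB_tA_t\big)_{t\in J}$, where $A_t=I$ if $t$ is a leaf or the root. **Theorem.** (1) For each $t\in J^-$ let $\mathrm R^{t}:\mathcal D_t\to \mathrm{St}(k_{t_L}k_{t_R},k_t)$ be a retraction on the Stiefel manifold $\mathrm{St}(k_{t_L}k_{t_R},k_t)$. Define $\mathrm R^\equiv_x(\xi)=(C_t)_{t\in J}$ for $x=(B_t)\in\mathcal T$, $\xi=(\delta B_t)\in T_x\mathcal T$ by $C_t=\mathrm R^t_{B_t}(\delta B_t)$ for $t\in J^-$ and $C_{t_B}=B_{t_B}+\delta B_{t_B}$. Then $\mathrm R^\equiv$ is a retraction on $\mathcal T$ with domain $\mathcal D^\equiv$, the set of all $(x,\xi)\in T\mathcal T$ such that $(B_t,\delta B_t)\in\mathcal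 D_t$ for all $t\in J^-$ and $\mathrm R^\equiv_x(\xi)$ is full rank. (2) The quotient $\mathcal T/\mathcal G$, with the quotient topology, has a smooth manifold structure for which the quotient map $\pi:\mathcal T\to\mathcal T/\mathcal G$ is a smooth submersion, and the following holds for it. Let $x\mapsto H_x$ be any horizontal space: a smooth family of complements $H_x$ of $\ker d\pi(x)$ in $T_x\mathcal T$ with $\theta(\cdot,A)(H_x)=H_{\theta(x,A)}$ for all $A\in\mathcal G$. For $p\in T_{[x]}(\mathcal T/\mathcal G)$ let $\mathrm{lift}_x(p)$ be the unique $h\in H_x$ with $d\pi(x)[h]=p$. If, in addition to the assumptions in (1), for all $t\in J^-$, all $(X,V)\in\mathcal D_t$ and all orthogonal matrices $Q,W$ of fitting sizes $$(QXW,QVW)\in\mathcal D_t,\qquad \mathrm R^t_{QXW}(QVW)=Q\,\mathrm R^t_X(V)\,W,$$ then $$\hat{\mathrm R}^\equiv_{[x]}(p)=\pi\big(\mathrm R^\equiv_x(\mathrm{lift}_x(p))\big)$$ is well defined, i.e. whether $(x,\mathrm{lift}_x(p))\in\mathcal D^\equiv$, and then the right-hand side, depend only on $p$ and not on the representative $x$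 of $[x]$, and $\hat{\mathrm R}^\equiv$ is a retraction on $\mathcal T/\mathcal G$ (with domain the set of $p$ with $(x,\mathrm{lift}_x(p))\in\mathcal D^\equiv$). (3) The equivariance condition of (2) holds for the polar map $(X,V)\mapsto (X+V)(I+V^TV)^{-1/2}$ and for the Cayley map $(X,V)\mapsto (I-\tfrac12 S)^{-1}(I+\tfrac12 S)X$, where $S=PVX^T-XV^TP$ and $P=I-\tfrac12XX^T$, on the whole tangent bundle of $\mathrm{St}(n,m)$, for all $n,m$. -/

import Mathlib

open scoped Manifold ContDiff Topology Kronecker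

namespace TTN

/-! ## Curves, tangent vectors and retractions on embedded submanifolds -/

section Embedded

variable {E : Type*} [NormedAddCommGroup E] [NormedSpace ℝ E]
  {F : Type*} [NormedAddCommGroup F] [NormedSpace ℝ F]

/-- `c` is a curve in `S`, smooth around the parameter `0`, with `c 0 = x` and velocity `v`. -/
structure IsCurveThrough (S : Set E) (c : ℝ → S) (x v : E) : Prop where
  start : (c 0 : E) = x
  velocity : HasDerivAt (fun s => (c s : E)) v 0
  smooth : ∃ ε > 0, ContDiffOn ℝ ∞ (fun s => (c s : E)) (Set.Ioo (-ε) ε)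

/-- The tangent space of an embedded submanifold `S` at `x`, as the set of the velocities of the
smooth curves in `S` through `x`. -/
def tangentVectors (S : Set E) (x : E) : Set E :=
  {v | ∃ c : ℝ → S, IsCurveThrough S c x v}

/-- The tangent bundle of an embedded submanifold `S` of `E`, as a subset of `E × E`. -/
def tangentPairs (S : Set E) : Set (E × E) :=
  {p | p.1 ∈ S ∧ p.2 ∈ tangentVectors S p.1}

/-- Smoothness of a map on an arbitrary subset of a normed space: local smooth extendability. -/
def IsSmoothOn (S : Set E) (f : E → F) : Prop :=
  ∀ x ∈ S, ∃ U : Set E, IsOpen U ∧ x ∈ U ∧ ∃ g : E → F, ContDiffOn ℝ ∞ g U ∧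
    Set.EqOn f g (U ∩ S)

/-- `R`, restricted to `D`, is a retraction on the embedded submanifold `M`: the domain `D` is an
open subset of the tangent bundle of `M` that contains the zero section, `R : D → M` is smooth, and
for every tangent vector `v` at `x` the curve `s ↦ R x (s v)` starts at `x` with velocity `v`.
The values of `R` outside `D` are irrelevant. `D = tangentPairs M` gives the retractions that are
defined on the whole tangent bundle. -/
structure IsRetraction (M : Set E) (D : Set (E × E)) (R : E → E → E) : Prop where
  isOpen_domain : ∃ U : Set (E × E), IsOpen U ∧ D = tangentPairs M ∩ U
  zero_mem : ∀ x ∈ M, (x, (0 : E)) ∈ D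
  mapsTo : ∀ p ∈ D, R p.1 p.2 ∈ M
  smooth : IsSmoothOn D (fun p : E × E => R p.1 p.2)
  map_zero : ∀ x ∈ M, R x 0 = x
  velocity : ∀ p ∈ tangentPairs M, HasDerivAt (fun s : ℝ => R p.1 (s • p.2)) p.2 0

end Embedded

/-! ## Maps from embedded submanifolds to abstract manifolds, retractions on manifolds -/

section Abstract

variable {E : Type*} [NormedAddCommGroup E] [NormedSpace ℝ E]
  {V : Type*} [NormedAddCommGroup V] [NormedSpace ℝ V]
  {B : Type*} [TopologicalSpace B] (I : ModelWithCorners ℝ V B)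
  {N : Type*} [TopologicalSpace N] [ChartedSpace B N]

/-- The curve `γ` in the manifold `N` is differentiable at the parameter `0`, where its point and
velocity are given by the tangent vector `p`. -/
def HasVelocity (γ : ℝ → N) (p : TangentBundle I N) : Prop :=
  MDifferentiableAt 𝓘(ℝ, ℝ) I γ 0 ∧
    tangentMap 𝓘(ℝ, ℝ) I γ (⟨0, (1 : ℝ)⟩ : TangentBundle 𝓘(ℝ, ℝ) ℝ) = p

/-- The differential of `f : S → N` sends the tangent vector `v` of `S` at `x` to `p`: for a smooth
curve `c` in `S` through `x` with velocity `v`, the curve `f ∘ c` has velocity `p`.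
(For smooth `f` the choice of `c` does not matter.) -/
def PushesTo {S : Set E} (f : S → N) (x v : E) (p : TangentBundle I N) : Prop :=
  ∃ c : ℝ → S, IsCurveThrough S c x v ∧ HasVelocity I (fun s => f (c s)) p

/-- `f` is a smooth submersion from the embedded submanifold `S` of `E` to the manifold `N`. -/
structure IsSmoothSubmersion {S : Set E} (f : S → N) : Prop where
  smooth : ∀ x : S, ∃ U : Set E, IsOpen U ∧ (x : E) ∈ U ∧ ∃ g : E → N,
    ContMDiffOn 𝓘(ℝ, E) I ∞ g U ∧ ∀ y : S, (y : E) ∈ U → f y = g y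
  surjective : ∀ (x : S) (w : TangentSpace I (f x)), ∃ v : E, PushesTo I f x v ⟨f x, w⟩

/-- `R`, restricted to `D`, is a retraction on the manifold `N`: the domain `D` is an open subset
of the tangent bundle that contains the zero section, `R : D → N` is smooth, and for every tangent
vector `w` at `q` the curve `s ↦ R q (s w)` starts at `q` with velocity `w`. -/
structure IsManifoldRetraction [IsManifold I ∞ N]
    (D : Set (TangentBundle I N)) (R : TangentBundle I N → N) : Prop where
  isOpen_domain : IsOpen D
  zero_mem : ∀ q : N, (⟨q, 0⟩ : TangentBundle I N) ∈ D
  smooth : ContMDiffOn I.tangent I ∞ R D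
  map_zero : ∀ q : N, R ⟨q, 0⟩ = q
  velocity : ∀ (q : N) (w : TangentSpace I q),
    HasVelocity I (fun s : ℝ => R ⟨q, s • w⟩) ⟨q, w⟩

end Abstract

/-! ## The Stiefel manifold -/

section Stiefel

variable {n m : Type*} [Fintype n] [DecidableEq n] [Fintype m] [DecidableEq m]

/-- The Stiefel manifold `St(n, m)` of real matrices with orthonormal columns. -/
def stiefel (n m : Type*) [Fintype n] [DecidableEq m] : Set (Matrix n m ℝ) :=
  {X | X.transpose * X = 1}

open scoped MatrixOrder in
/-- The polar map `(X, V) ↦ (X + V) (I + Vᵀ V)^(-1/2)`. -/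
noncomputable def polarMap (X V : Matrix n m ℝ) : Matrix n m ℝ :=
  (X + V) * (CFC.sqrt (1 + V.transpose * V))⁻¹

/-- The skew-symmetric generator `P V Xᵀ - X Vᵀ P`, `P = I - X Xᵀ / 2`, of the Cayley map. -/
noncomputable def cayleyGenerator (X V : Matrix n m ℝ) : Matrix n n ℝ :=
  (1 - (1 / 2 : ℝ) • (X * X.transpose)) * V * X.transpose
    - X * V.transpose * (1 - (1 / 2 : ℝ) • (X * X.transpose))

/-- The Cayley map `(X, V) ↦ (I - W / 2)⁻¹ (I + W / 2) X`, `W = P V Xᵀ - X Vᵀ P`. -/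
noncomputable def cayleyMap (X V : Matrix n m ℝ) : Matrix n m ℝ :=
  (1 - (1 / 2 : ℝ) • cayleyGenerator X V)⁻¹ * (1 + (1 / 2 : ℝ) • cayleyGenerator X V) * X

/-- `R : D → St(n, m)` is equivariant under multiplication by orthogonal matrices from the left and
from the right (and so is its domain `D`). -/
def IsOrthogonallyEquivariant (D : Set (Matrix n m ℝ × Matrix n m ℝ))
    (R : Matrix n m ℝ → Matrix n m ℝ → Matrix n m ℝ) : Prop :=
  ∀ Q ∈ Matrix.orthogonalGroup n ℝ, ∀ W ∈ Matrix.orthogonalGroup m ℝ, ∀ X V, (X, V) ∈ D →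
    (Q * X * W, Q * V * W) ∈ D ∧ R (Q * X * W) (Q * V * W) = Q * R X V * W

end Stiefel

/-! ## Dimension trees and tree tensor networks -/

/-- A dimension tree over `{0, …, d - 1}`: a non-trivial rooted binary tree whose nodes are labelled
by (and identified with) subsets. The root is the full set, the external nodes are singletons, and
each other node is the disjoint union of its two children, ordered from left to right. -/
structure DimensionTree (d : ℕ) where
  nodes : Finset (Finset (Fin d))
  left : Finset (Fin d) → Finset (Fin d)
  right : Finset (Fin d) → Finset (Fin d)
  nontrivial : 2 ≤ d
  root_mem : Finset.univ ∈ nodes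
  nonempty : ∀ t ∈ nodes, t.Nonempty
  left_mem : ∀ t ∈ nodes, 2 ≤ t.card → left t ∈ nodes
  right_mem : ∀ t ∈ nodes, 2 ≤ t.card → right t ∈ nodes
  left_union_right : ∀ t ∈ nodes, 2 ≤ t.card → left t ∪ right t = t
  left_lt_right : ∀ t ∈ nodes, 2 ≤ t.card → ∀ μ ∈ left t, ∀ ν ∈ right t, μ < ν
  exists_parent : ∀ t ∈ nodes, t ≠ Finset.univ →
    ∃ s ∈ nodes, 2 ≤ s.card ∧ (t = left s ∨ t = right s)

/-- The internal nodes `J` (the root included). -/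
abbrev DimensionTree.Internal {d : ℕ} (T : DimensionTree d) : Type :=
  {t : Finset (Fin d) // t ∈ T.nodes ∧ 2 ≤ t.card}

/-- The internal nodes `J⁻` other than the root. -/
abbrev DimensionTree.NonRoot {d : ℕ} (T : DimensionTree d) : Type :=
  {t : T.Internal // t.1 ≠ Finset.univ}

/-- Real `a × b × c` arrays, written as their matricizations `B^(1,2)` with respect to the first two
indices. -/
abbrev Tensor (a b c : ℕ) : Type := Matrix (Fin a × Fin b) (Fin c) ℝ

/-- The matricization `B^(1)` with respect to the first index. -/
def mat1 {a b c : ℕ} (X : Tensor a b c) : Matrix (Fin a) (Fin b × Fin c) ℝ :=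
  Matrix.of fun i p => X (i, p.1) p.2

/-- The matricization `B^(2)` with respect to the second index. -/
def mat2 {a b c : ℕ} (X : Tensor a b c) : Matrix (Fin b) (Fin a × Fin c) ℝ :=
  Matrix.of fun j p => X (p.1, j) p.2

/- Matrix spaces carry the entrywise maximum norm; only its (unique vector space) topology and
smooth structure matter. -/
attribute [local instance] Matrix.normedAddCommGroup Matrix.normedSpace

section Network

variable {d : ℕ} (T : DimensionTree d) (k : Finset (Fin d) → ℕ)

/-- The tensor space at the internal node `t`. -/
abbrev NodeSpace (t : T.Internal) : Type := Tensor (k (T.left t.1)) (k (T.right t.1)) (k t.1)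

/-- The Euclidean space of all TTN parameters `x = (B_t)`. -/
abbrev Param : Type := ∀ t : T.Internal, NodeSpace T k t

/-- A parameter is full rank: `B_t^(1,2)` has full column rank at the internal nodes other than the
root, `B_t^(1)` and `B_t^(2)` have full rank at the internal nodes with more than two elements. -/
def IsFullRank (x : Param T k) : Prop :=
  (∀ t : T.NonRoot, (x t.1).rank = k t.1.1) ∧
  ∀ t : T.Internal, t.1.card ≠ 2 →
    (mat1 (x t)).rank = min (k (T.left t.1)) (k (T.right t.1) * k t.1) ∧
    (mat2 (x t)).rank = min (k (T.right t.1)) (k (T.left t.1) * k t.1)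

/-- The manifold `𝒯` of orthogonal (in particular full-rank) TTN parameters. -/
def orthTTN : Set (Param T k) :=
  {x | IsFullRank T k x ∧ ∀ t : T.NonRoot, x t.1 ∈ stiefel _ _}

/-- The group `𝒢` of families of orthogonal matrices, one for each node of `J⁻`. -/
abbrev GaugeGroup : Type := ∀ t : T.NonRoot, Matrix.orthogonalGroup (Fin (k t.1.1)) ℝ

variable {T k}

/-- The matrix `A_t` of a gauge `A` at any label `t`; it is the identity at the root and at the
external nodes. -/
def gaugeAt (A : GaugeGroup T k) (t : Finset (Fin d)) : Matrix (Fin (k t)) (Fin (k t)) ℝ :=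
  if h : (t ∈ T.nodes ∧ 2 ≤ t.card) ∧ t ≠ Finset.univ then (A ⟨⟨t, h.1⟩, h.2⟩).1 else 1

/-- The (linear) action `θ(x, A) = ((A_{t_L} ⊗ A_{t_R})ᵀ B_t A_t)`. -/
def gaugeAct (x : Param T k) (A : GaugeGroup T k) : Param T k := fun t =>
  (gaugeAt A (T.left t.1) ⊗ₖ gaugeAt A (T.right t.1)).transpose * x t * gaugeAt A t.1

theorem gaugeAt_one (t : Finset (Fin d)) : gaugeAt (1 : GaugeGroup T k) t = 1 := by
  unfold gaugeAt; split_ifs <;> rfl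

theorem gaugeAt_mul (A A' : GaugeGroup T k) (t : Finset (Fin d)) :
    gaugeAt (A * A') t = gaugeAt A t * gaugeAt A' t := by
  unfold gaugeAt; split_ifs
  · rfl
  · simp

theorem gaugeAct_one (x : Param T k) : gaugeAct x 1 = x := by
  funext t; simp [gaugeAct, gaugeAt_one]

theorem gaugeAct_mul (x : Param T k) (A A' : GaugeGroup T k) :
    gaugeAct x (A * A') = gaugeAct (gaugeAct x A) A' := by
  funext t
  simp only [gaugeAct, gaugeAt_mul, Matrix.mul_kronecker_mul, Matrix.transpose_mul,
    Matrix.mul_assoc]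

variable (T k)

/-- Two orthogonal parameters are equivalent if they lie on the same orbit of the gauge group. -/
def orbitSetoid : Setoid (orthTTN T k) where
  r x y := ∃ A : GaugeGroup T k, y.1 = gaugeAct x.1 A
  iseqv :=
    { refl := fun x => ⟨1, (gaugeAct_one x.1).symm⟩
      symm := by
        rintro x y ⟨A, h⟩
        exact ⟨A⁻¹, by rw [h, ← gaugeAct_mul, mul_inv_cancel, gaugeAct_one]⟩
      trans := by
        rintro x y z ⟨A, h⟩ ⟨A', h'⟩
        exact ⟨A * A', by rw [h', h, gaugeAct_mul]⟩ }

/-- The quotient `𝒯/𝒢`, with the quotient topology. -/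
abbrev TTNQuotient : Type := Quotient (orbitSetoid T k)

/-- The quotient map `π : 𝒯 → 𝒯/𝒢`. -/
def quotMap (x : orthTTN T k) : TTNQuotient T k := Quotient.mk _ x

/-- Families of sets of pairs of matrices, one set for each node of `J⁻`: the candidates for the
domains of retractions on the Stiefel manifolds. -/
abbrev NodeDomains : Type :=
  ∀ t : T.NonRoot, Set (NodeSpace T k t.1 × NodeSpace T k t.1)

/-- Families of maps `(X, V) ↦ R_X(V)` on pairs of matrices, one map for each node of `J⁻`. -/
abbrev NodeMaps : Type :=
  ∀ t : T.NonRoot, NodeSpace T k t.1 → NodeSpace T k t.1 → NodeSpace T k t.1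

variable {T k}

/-- The Cartesian retraction: apply `R t` at the nodes `t` of `J⁻` and add at the root. -/
def cartesianRetraction (R : NodeMaps T k) (x ξ : Param T k) : Param T k := fun t =>
  if h : t.1 ≠ Finset.univ then R ⟨t, h⟩ (x t) (ξ t) else x t + ξ t

/-- The natural domain of the Cartesian retraction: the tangent vectors of `𝒯` at which the
retractions at the nodes are defined and the resulting parameter is full rank. -/
def cartesianDomain (D : NodeDomains T k) (R : NodeMaps T k) : Set (Param T k × Param T k) :=
  {p | p ∈ tangentPairs (orthTTN T k) ∧
    (∀ t : T.NonRoot, (p.1 t.1, p.2 t.1) ∈ D t) ∧ IsFullRank T k (cartesianRetraction R p.1 p.2)}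

/-- `R t` is, for each node `t` of `J⁻`, a retraction with domain `D t` on the Stiefel manifold
`St(k_{t_L} k_{t_R}, k_t)`. -/
def AreStiefelRetractions (D : NodeDomains T k) (R : NodeMaps T k) : Prop :=
  ∀ t : T.NonRoot, IsRetraction (stiefel _ _) (D t) (R t)

section Horizontal

variable {V : Type*} [NormedAddCommGroup V] [NormedSpace ℝ V]
  {B : Type*} [TopologicalSpace B] (I : ModelWithCorners ℝ V B)
  [ChartedSpace B (TTNQuotient T k)]

/-- The vertical space `ker dπ(x)`, a subset of the tangent space of `𝒯` at `x`. -/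
def verticalVectors (x : orthTTN T k) : Set (Param T k) :=
  {v | PushesTo I (quotMap T k) x.1 v ⟨quotMap T k x, 0⟩}

/-- `H` is a horizontal space: `H x` is a complement of the vertical space in the tangent space of
`𝒯` at each `x`, depends smoothly on `x` (has local smooth frames), and is invariant under `𝒢`. -/
structure IsHorizontal (H : Param T k → Submodule ℝ (Param T k)) : Prop where
  subset : ∀ x ∈ orthTTN T k, (H x : Set (Param T k)) ⊆ tangentVectors (orthTTN T k) x
  complement : ∀ x : orthTTN T k, ∀ v ∈ tangentVectors (orthTTN T k) x.1,
    ∃! h : Param T k, h ∈ H x.1 ∧ v - h ∈ verticalVectors I x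
  smooth : ∀ x ∈ orthTTN T k, ∃ U : Set (Param T k), IsOpen U ∧ x ∈ U ∧
    ∃ (r : ℕ) (X : Fin r → Param T k → Param T k), (∀ i, ContDiffOn ℝ ∞ (X i) U) ∧
      ∀ y ∈ U ∩ orthTTN T k, LinearIndependent ℝ (fun i => X i y) ∧
        Submodule.span ℝ (Set.range fun i => X i y) = H y
  invariant : ∀ x ∈ orthTTN T k, ∀ (A : GaugeGroup T k) (v : Param T k),
    v ∈ H x ↔ gaugeAct v A ∈ H (gaugeAct x A)

/-- `h` is the horizontal lift at `x` of the tangent vector `p` of `𝒯/𝒢`. -/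
def IsHorizontalLift (H : Param T k → Submodule ℝ (Param T k)) (x : orthTTN T k)
    (p : TangentBundle I (TTNQuotient T k)) (h : Param T k) : Prop :=
  h ∈ H x.1 ∧ PushesTo I (quotMap T k) x.1 h p

/-- `Rq`, with domain `Dq`, is the map that the map `R : D → 𝒯` with `D` in the tangent bundle of
`𝒯` induces on the tangent bundle of `𝒯/𝒢` through horizontal lifts: each tangent vector `p` at
`[x]` has a unique horizontal lift `h` at `x`, `p` is in `Dq` if and only if `(x, h)` is in `D`, and
in this case `Rq p = π (R x h)`. As this holds for all representatives `x`, the equivalence class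
of `R x h` does not depend on the representative. -/
def IsInducedMap (H : Param T k → Submodule ℝ (Param T k))
    (D : Set (Param T k × Param T k)) (R : Param T k → Param T k → Param T k)
    (Dq : Set (TangentBundle I (TTNQuotient T k)))
    (Rq : TangentBundle I (TTNQuotient T k) → TTNQuotient T k) : Prop :=
  ∀ (x : orthTTN T k) (p : TangentBundle I (TTNQuotient T k)), p.1 = quotMap T k x →
    (∃! h : Param T k, IsHorizontalLift I H x p h) ∧
    ∀ h : Param T k, IsHorizontalLift I H x p h →
      (p ∈ Dq ↔ (x.1, h) ∈ D) ∧
      ((x.1, h) ∈ D → ∃ hR : R x.1 h ∈ orthTTN T k, Rq p = quotMap T k ⟨R x.1 h, hR⟩)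

end Horizontal

end Network

end TTN

open TTN

attribute [local instance] Matrix.normedAddCommGroup Matrix.normedSpace

/-!
The manifold `𝒯` is open (full rank) in a product of Stiefel manifolds and a vector space. A product
of retractions on the factors is therefore a retraction, once its domain is cut down to the tangent
vectors that stay full rank; this is `isRetraction_cartesianRetraction`.

The quotient `𝒯/𝒢` agrees with the quotient of the full-rank parameters by invertible changes of
bases, `B_t ↦ (G_{t_L} ⊗ G_{t_R}) B_t G_t⁻¹`: if such a change of bases relates two points of `𝒯`,
then it is orthogonal, by induction from the leaves (`exists_gauge`). This yields charts. Near a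
point `(B⁰_t)`, each orbit of the larger group contains a unique normal form, `B⁰_tᵀ C_t = 1` for
`t ∈ J⁻`, which is a rational function of the parameter (`normalForm`) and lies in an affine space.
Conversely, replacing `C_t` from the leaves upwards by `Y_t (Y_tᵀ Y_t)^(-1/2)` turns a normal form
into a point of `𝒯` that depends smoothly on it (`orthFamily`, `contDiffWithinAt_psqrt`). So the
normal form is an invariant submersion that separates orbits and has local sections through each
point, and the maps that it induces on the quotient are compatible charts
(`SliceChart`, `exists_sliceChart`). Neither freeness of the action nor the slice theorem for compact
groups is needed.

In such a chart `φ`, the horizontal lift of a tangent vector at `x` is the solution `h ∈ H_x` of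
`dφ(x) h = w`, and a smooth frame of `H` makes it a smooth function of the coordinates
(`SliceChart.exists_smooth_lift`). Gauge invariance of `H` and equivariance of the retraction show
that the induced map does not depend on the representative (`exists_isInducedMap`), and that it is a
retraction is read off in the charts (`IsInducedMap.isManifoldRetraction`).

The polar and the Cayley map are equivariant because square roots and inverses commute with
orthogonal conjugation.
-/

namespace TTN

/-! ### Smoothness of matrix operations and openness of rank conditions -/

section MatrixSmooth

variable {E : Type*} [NormedAddCommGroup E] [NormedSpace ℝ E]
variable {l m n p : Type*} [Fintype l] [Fintype m] [Fintype n] [Fintype p]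
  {s : Set E} {x : E} {r : ℕ∞ω}

theorem contDiffWithinAt_matrix {f : E → Matrix m n ℝ} :
    ContDiffWithinAt ℝ r f s x ↔ ∀ i j, ContDiffWithinAt ℝ r (fun y => f y i j) s x := by
  refine (contDiffWithinAt_pi (𝕜 := ℝ) (Φ := f)).trans (forall_congr' fun i => ?_)
  exact contDiffWithinAt_pi (𝕜 := ℝ) (Φ := fun y => f y i)

theorem ContDiffWithinAt.matrix_mul {f : E → Matrix l m ℝ} {g : E → Matrix m n ℝ}
    (hf : ContDiffWithinAt ℝ r f s x) (hg : ContDiffWithinAt ℝ r g s x) :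
    ContDiffWithinAt ℝ r (fun y => f y * g y) s x := by
  rw [contDiffWithinAt_matrix] at *
  intro i j
  simp only [Matrix.mul_apply]
  exact ContDiffWithinAt.sum fun k _ => (hf i k).mul (hg k j)

theorem ContDiffWithinAt.matrix_transpose {f : E → Matrix m n ℝ}
    (hf : ContDiffWithinAt ℝ r f s x) :
    ContDiffWithinAt ℝ r (fun y => (f y).transpose) s x := by
  rw [contDiffWithinAt_matrix] at *
  exact fun i j => hf j i

theorem ContDiffWithinAt.matrix_kronecker {f : E → Matrix l m ℝ} {g : E → Matrix n p ℝ}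
    (hf : ContDiffWithinAt ℝ r f s x) (hg : ContDiffWithinAt ℝ r g s x) :
    ContDiffWithinAt ℝ r (fun y => f y ⊗ₖ g y) s x := by
  rw [contDiffWithinAt_matrix] at *
  exact fun i j => (hf i.1 j.1).mul (hg i.2 j.2)

theorem ContDiffWithinAt.matrix_det [DecidableEq m] {f : E → Matrix m m ℝ}
    (hf : ContDiffWithinAt ℝ r f s x) :
    ContDiffWithinAt ℝ r (fun y => (f y).det) s x := by
  rw [contDiffWithinAt_matrix] at hf
  simp only [Matrix.det_apply]
  exact ContDiffWithinAt.sum fun σ _ =>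
    (contDiffWithinAt_prod fun i _ => hf (σ i) i).const_smul _

theorem ContDiffWithinAt.matrix_inv [DecidableEq m] {f : E → Matrix m m ℝ}
    (hf : ContDiffWithinAt ℝ r f s x) (h : IsUnit (f x).det) :
    ContDiffWithinAt ℝ r (fun y => (f y)⁻¹) s x := by
  have hadj : ContDiffWithinAt ℝ r (fun y => (f y).adjugate) s x := by
    rw [contDiffWithinAt_matrix]
    intro i j
    simp only [Matrix.adjugate_apply]
    refine ContDiffWithinAt.matrix_det (contDiffWithinAt_matrix.2 fun a b => ?_)
    rw [contDiffWithinAt_matrix] at hf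
    by_cases hja : a = j
    · subst hja
      simpa using contDiffWithinAt_const
    · simpa [Matrix.updateRow_ne hja] using hf a b
  have := (hf.matrix_det.inv h.ne_zero)
  simp only [Matrix.inv_def, Ring.inverse_eq_inv']
  exact this.smul hadj

end MatrixSmooth

section Rank

variable {X : Type*} [TopologicalSpace X] {m n : Type*} [Fintype m] [Fintype n]

theorem isOpen_le_rank (r : ℕ) : IsOpen {A : Matrix m n ℝ | r ≤ A.rank} := by
  classical
  have hc : Continuous fun A : Matrix m n ℝ =>
      LinearMap.toContinuousLinearMap (Matrix.mulVecLin A) := by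
    refine LinearMap.continuous_of_finiteDimensional
      (((LinearMap.toContinuousLinearMap : ((n → ℝ) →ₗ[ℝ] (m → ℝ)) ≃ₗ[ℝ] _).toLinearMap).comp
        (Matrix.toLin' : Matrix m n ℝ ≃ₗ[ℝ] _).toLinearMap)
  have := (isOpen_setOfPred_nat_le_rank (𝕜 := ℝ) (E := n → ℝ) (F := m → ℝ) r).preimage hc
  convert this using 1
  ext A
  simp only [Set.mem_preimage, Set.mem_ofPred_eq, Matrix.rank]
  rw [LinearMap.rank, ← Module.finrank_eq_rank]
  exact Nat.cast_le.symm

end Rank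

/-! ### The square root of positive definite matrices -/

/-- Symmetric matrices close to a positive definite matrix are positive definite. -/
theorem eventually_posDef {n : Type*} [Fintype n] {S : Matrix n n ℝ} (hS : S.PosDef) :
    ∀ᶠ A in 𝓝 S, A.IsHermitian → A.PosDef := by
  have hc : Continuous fun p : Matrix n n ℝ × (n → ℝ) => p.2 ⬝ᵥ p.1.mulVec p.2 := by
    refine continuous_finsetSum _ fun i _ => ?_
    refine ((continuous_apply i).comp continuous_snd).mul (continuous_finsetSum _ fun j _ => ?_)
    exact ((continuous_id.matrix_elem i j).comp continuous_fst).mul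
      ((continuous_apply j).comp continuous_snd)
  obtain ⟨u, v, hu, -, hSu, hv, huv⟩ := generalized_tube_lemma (isCompact_singleton (x := S))
    (isCompact_sphere (0 : n → ℝ) 1) (isOpen_lt continuous_const hc) (n := {p | 0 < _}) (by
      rintro ⟨A, x⟩ ⟨hA, hx⟩
      rw [Set.mem_singleton_iff] at hA
      subst hA
      have hx0 : x ≠ 0 := by
        rintro rfl
        simp at hx
      simpa using hS.dotProduct_mulVec_pos hx0)
  filter_upwards [hu.mem_nhds (hSu rfl)] with A hA hherm
  refine Matrix.posDef_iff_dotProduct_mulVec.2 ⟨hherm, fun x hx => ?_⟩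
  have hn : 0 < ‖x‖ := norm_pos_iff.2 hx
  have h1 : (A, ‖x‖⁻¹ • x) ∈ {p : Matrix n n ℝ × (n → ℝ) | 0 < p.2 ⬝ᵥ p.1.mulVec p.2} :=
    huv ⟨hA, hv (by simp [norm_smul, hn.ne'])⟩
  simp only [Set.mem_ofPred_eq, Matrix.mulVec_smul, smul_dotProduct, dotProduct_smul,
    smul_eq_mul] at h1
  rw [star_trivial]
  exact pos_of_mul_pos_right (pos_of_mul_pos_right h1 (by positivity)) (by positivity)

section Sqrt

open scoped MatrixOrder

variable {n m : Type*} [Fintype n] [DecidableEq n] [Fintype m] [DecidableEq m]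

/-- The positive semidefinite square root of a real positive semidefinite matrix. -/
noncomputable def psqrt (A : Matrix n n ℝ) : Matrix n n ℝ := CFC.sqrt A

theorem psqrt_posSemidef (A : Matrix n n ℝ) : (psqrt A).PosSemidef :=
  Matrix.nonneg_iff_posSemidef.1 (CFC.sqrt_nonneg A)

theorem psqrt_mul_self {A : Matrix n n ℝ} (h : A.PosSemidef) : psqrt A * psqrt A = A :=
  CFC.sqrt_mul_sqrt_self A (Matrix.nonneg_iff_posSemidef.2 h)

theorem psqrt_unique {A S : Matrix n n ℝ} (h : S * S = A) (hS : S.PosSemidef) : psqrt A = S :=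
  CFC.sqrt_unique h (Matrix.nonneg_iff_posSemidef.2 hS)

theorem psqrt_transpose (A : Matrix n n ℝ) : (psqrt A).transpose = psqrt A := by
  have := (psqrt_posSemidef A).isHermitian
  rwa [Matrix.IsHermitian, Matrix.conjTranspose_eq_transpose_of_trivial] at this

theorem isUnit_det_psqrt {A : Matrix n n ℝ} (h : A.PosDef) : IsUnit (psqrt A).det := by
  have h1 : IsUnit (psqrt A * psqrt A).det := by
    rw [psqrt_mul_self h.posSemidef]
    exact (Matrix.isUnit_iff_isUnit_det _).1 h.isUnit
  rw [Matrix.det_mul] at h1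
  exact isUnit_of_mul_isUnit_left h1

theorem psqrt_posDef {A : Matrix n n ℝ} (h : A.PosDef) : (psqrt A).PosDef :=
  (psqrt_posSemidef A).posDef_iff_isUnit.2
    ((Matrix.isUnit_iff_isUnit_det _).2 (isUnit_det_psqrt h))

/-- The Sylvester operator `H ↦ S H + H S` of a positive definite matrix is injective: the trace
of `Hᵀ (S H + H S)` is the sum of the traces of `Hᵀ S H` and `H S Hᵀ`. -/
theorem eq_zero_of_sylvester {S H : Matrix n n ℝ} (hS : S.PosDef) (h : S * H + H * S = 0) :
    H = 0 := by
  have h1 := hS.posSemidef.conjTranspose_mul_mul_same H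
  have h2 := hS.posSemidef.mul_mul_conjTranspose_same H
  simp only [Matrix.conjTranspose_eq_transpose_of_trivial] at h1 h2
  have h3 : (H.transpose * S * H).trace + (H * S * H.transpose).trace = 0 := by
    rw [Matrix.trace_mul_comm (H * S), ← Matrix.trace_add, Matrix.mul_assoc, ← Matrix.mul_add, h]
    simp
  have h4 : (H.transpose * S * H).trace = 0 := by
    linarith [h1.trace_nonneg, h2.trace_nonneg]
  have h5 : H.transpose * S * H = 0 := h1.trace_eq_zero_iff.1 h4
  refine Matrix.ext_of_mulVec_single fun i => ?_
  by_contra hne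
  rw [Matrix.zero_mulVec] at hne
  have h6 := hS.dotProduct_mulVec_pos hne
  have h7 : star (H.mulVec (Pi.single i 1)) ⬝ᵥ S.mulVec (H.mulVec (Pi.single i 1)) =
      Pi.single i 1 ⬝ᵥ (H.transpose * S * H).mulVec (Pi.single i 1) := by
    simp only [star_trivial, ← Matrix.mulVec_mulVec, Matrix.dotProduct_mulVec,
      Matrix.vecMul_transpose]
  rw [h7, h5] at h6
  simp at h6

/-- The square root is smooth on the positive definite matrices, by the inverse function theorem
for the squaring map. -/
theorem contDiffWithinAt_psqrt {P : Matrix n n ℝ} (hP : P.PosDef) :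
    ContDiffWithinAt ℝ ∞ (psqrt : Matrix n n ℝ → Matrix n n ℝ) {A | A.IsHermitian} P := by
  set S := psqrt P with hSdef
  have hS : S.PosDef := psqrt_posDef hP
  let f : Matrix n n ℝ → Matrix n n ℝ := fun X => X * X
  have hf : ContDiffAt ℝ ∞ f S :=
    ContDiffWithinAt.matrix_mul contDiffWithinAt_id contDiffWithinAt_id
  let L : Matrix n n ℝ →ₗ[ℝ] Matrix n n ℝ := LinearMap.mulLeft ℝ S + LinearMap.mulRight ℝ S
  have hL : Function.Injective L := by
    refine (injective_iff_map_eq_zero L).2 fun H hH => eq_zero_of_sylvester hS ?_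
    simpa [L] using hH
  let f' : Matrix n n ℝ ≃L[ℝ] Matrix n n ℝ :=
    (LinearEquiv.ofInjectiveEndo L hL).toContinuousLinearEquiv
  have hf' : HasFDerivAt f (f' : Matrix n n ℝ →L[ℝ] Matrix n n ℝ) S := by
    have := (LinearMap.mul ℝ (Matrix n n ℝ)).toContinuousBilinearMap.hasFDerivAt_of_bilinear
      (hasFDerivAt_id S) (hasFDerivAt_id S)
    refine this.congr_fderiv ?_
    ext1 H
    change S * H + H * S = LinearEquiv.ofInjectiveEndo L hL H
    simp [L]
  let e := hf.toOpenPartialHomeomorph f hf' (by simp)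
  have hfS : f S = P := psqrt_mul_self hP.posSemidef
  have hSe : S ∈ e.source := hf.mem_toOpenPartialHomeomorph_source hf' (by simp)
  have hPe : P ∈ e.target := by
    have := e.map_source hSe
    rwa [show e S = P from hfS] at this
  have hinv : ContDiffAt ℝ ∞ e.symm P := by
    have := hf.to_localInverse hf' (by simp)
    rwa [hfS] at this
  have heS : e.symm P = S := by
    rw [← hfS]
    exact e.left_inv hSe
  refine hinv.contDiffWithinAt.congr_of_eventuallyEq ?_ heS.symm
  -- Close to `P`, the local inverse of the squaring map takes positive definite values: it commutes
  -- with transposition by local uniqueness.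
  have hct : Filter.Tendsto e.symm (𝓝 P) (𝓝 S) := by
    have := hinv.continuousAt.tendsto
    rwa [heS] at this
  have htr : Filter.Tendsto (fun A : Matrix n n ℝ => A.transpose) (𝓝 S) (𝓝 S) := by
    have : Continuous fun A : Matrix n n ℝ => A.transpose := continuous_id.matrix_transpose
    have h := this.tendsto S
    rwa [psqrt_transpose] at h
  have h1 := hct.eventually (htr.eventually (e.open_source.mem_nhds hSe))
  have h2 := hct.eventually (eventually_posDef hS)
  have h3 := e.open_target.mem_nhds hPe
  filter_upwards [nhdsWithin_le_nhds h1, nhdsWithin_le_nhds h2, nhdsWithin_le_nhds h3,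
    self_mem_nhdsWithin] with A hA1 hA2 hA3 hA4
  have hsq : e.symm A * e.symm A = A := e.right_inv hA3
  have hT : (e.symm A).transpose = e.symm A := by
    refine e.injOn hA1 (e.map_target hA3) ?_
    change (e.symm A).transpose * (e.symm A).transpose = e.symm A * e.symm A
    rw [← Matrix.transpose_mul, hsq]
    exact hA4
  exact psqrt_unique hsq (hA2 (by
    rwa [Matrix.IsHermitian, Matrix.conjTranspose_eq_transpose_of_trivial])).posSemidef

/-- The square root commutes with orthogonal conjugation. -/
theorem psqrt_conj {A W : Matrix n n ℝ} (hA : A.PosSemidef)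
    (hW : W * W.transpose = 1) : psqrt (W.transpose * A * W) = W.transpose * psqrt A * W := by
  refine psqrt_unique ?_ ?_
  · rw [show W.transpose * psqrt A * W * (W.transpose * psqrt A * W) =
        W.transpose * psqrt A * (W * W.transpose) * psqrt A * W by simp only [Matrix.mul_assoc],
      hW, Matrix.mul_one, Matrix.mul_assoc W.transpose, psqrt_mul_self hA]
  · simpa using (psqrt_posSemidef A).conjTranspose_mul_mul_same W

end Sqrt

/-! ### Recursion over the tree and changes of bases -/

section Tree

variable {d : ℕ} {T : DimensionTree d}

theorem DimensionTree.card_left_lt {t : Finset (Fin d)} (ht : t ∈ T.nodes) (h2 : 2 ≤ t.card) :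
    (T.left t).card < t.card := by
  obtain ⟨ν, hν⟩ := T.nonempty _ (T.right_mem t ht h2)
  have hu := T.left_union_right t ht h2
  refine Finset.card_lt_card ⟨fun μ hμ => hu ▸ Finset.mem_union_left _ hμ, fun hsub => ?_⟩
  exact lt_irrefl ν
    (T.left_lt_right t ht h2 ν (hsub (hu ▸ Finset.mem_union_right _ hν)) ν hν)

theorem DimensionTree.card_right_lt {t : Finset (Fin d)} (ht : t ∈ T.nodes) (h2 : 2 ≤ t.card) :
    (T.right t).card < t.card := by
  obtain ⟨ν, hν⟩ := T.nonempty _ (T.left_mem t ht h2)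
  have hu := T.left_union_right t ht h2
  refine Finset.card_lt_card ⟨fun μ hμ => hu ▸ Finset.mem_union_right _ hμ, fun hsub => ?_⟩
  exact lt_irrefl ν
    (T.left_lt_right t ht h2 ν hν ν (hsub (hu ▸ Finset.mem_union_left _ hν)))

variable (T) in
/-- The label `t` belongs to `J⁻`: it is an internal node other than the root. -/
def IsNonRoot (t : Finset (Fin d)) : Prop := (t ∈ T.nodes ∧ 2 ≤ t.card) ∧ t ≠ Finset.univ

theorem NonRoot.isNonRoot (t : T.NonRoot) : IsNonRoot T t.1.1 := ⟨t.1.2, t.2⟩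

/-- Induction from the leaves of the tree towards the root. -/
theorem nodeInduction {motive : Finset (Fin d) → Prop}
    (out : ∀ t, ¬ IsNonRoot T t → motive t)
    (step : ∀ t : T.NonRoot, motive (T.left t.1.1) → motive (T.right t.1.1) → motive t.1.1)
    (t : Finset (Fin d)) : motive t := by
  induction hn : t.card using Nat.strong_induction_on generalizing t with
  | _ n ih =>
    by_cases h : IsNonRoot T t
    · exact step ⟨⟨t, h.1⟩, h.2⟩
        (ih _ (hn ▸ DimensionTree.card_left_lt h.1.1 h.1.2) _ rfl)
        (ih _ (hn ▸ DimensionTree.card_right_lt h.1.1 h.1.2) _ rfl)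
    · exact out t h

variable {k : Finset (Fin d) → ℕ}

variable (k) in
/-- Families of square matrices, one for each label. -/
abbrev Family : Type := ∀ t : Finset (Fin d), Matrix (Fin (k t)) (Fin (k t)) ℝ

open scoped Classical in
/-- The family of square matrices that is the identity outside of `J⁻` and is determined at the
nodes of `J⁻` from the matrices at the two children through `F`. -/
noncomputable def treeRec
    (F : ∀ t : T.NonRoot, Matrix (Fin (k (T.left t.1.1))) (Fin (k (T.left t.1.1))) ℝ →
      Matrix (Fin (k (T.right t.1.1))) (Fin (k (T.right t.1.1))) ℝ →
      Matrix (Fin (k t.1.1)) (Fin (k t.1.1)) ℝ)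
    (t : Finset (Fin d)) : Matrix (Fin (k t)) (Fin (k t)) ℝ :=
  if h : IsNonRoot T t then
    F ⟨⟨t, h.1⟩, h.2⟩ (treeRec F (T.left t)) (treeRec F (T.right t))
  else 1
termination_by t.card
decreasing_by
  · exact DimensionTree.card_left_lt h.1.1 h.1.2
  · exact DimensionTree.card_right_lt h.1.1 h.1.2

section

variable (F : ∀ t : T.NonRoot, Matrix (Fin (k (T.left t.1.1))) (Fin (k (T.left t.1.1))) ℝ →
  Matrix (Fin (k (T.right t.1.1))) (Fin (k (T.right t.1.1))) ℝ →
  Matrix (Fin (k t.1.1)) (Fin (k t.1.1)) ℝ)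

theorem treeRec_nonRoot (t : T.NonRoot) :
    treeRec F t.1.1 = F t (treeRec F (T.left t.1.1)) (treeRec F (T.right t.1.1)) := by
  rw [treeRec, dif_pos (NonRoot.isNonRoot t)]

theorem treeRec_out {t : Finset (Fin d)} (h : ¬ IsNonRoot T t) : treeRec F t = 1 := by
  rw [treeRec, dif_neg h]

end

/-- The action of a family of square matrices by a change of bases,
`(G_{t_L} ⊗ G_{t_R}) B_t G_t⁻¹`. -/
noncomputable def glAct (G : Family k) (x : Param T k) : Param T k := fun t =>
  (G (T.left t.1) ⊗ₖ G (T.right t.1)) * x t * (G t.1)⁻¹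

theorem glAct_glAct (G H : Family k) (x : Param T k) :
    glAct G (glAct H x) = glAct (fun t => G t * H t) x := by
  funext t
  simp only [glAct, Matrix.mul_kronecker_mul, Matrix.mul_inv_rev, Matrix.mul_assoc]

theorem glAct_one (x : Param T k) : glAct (fun _ => 1 : Family k) x = x := by
  funext t
  simp [glAct]

theorem glAct_inv_glAct {G : Family k} (hG : ∀ t, IsUnit (G t).det) (x : Param T k) :
    glAct (fun t => (G t)⁻¹) (glAct G x) = x := by
  rw [glAct_glAct]
  simp only [Matrix.nonsing_inv_mul _ (hG _)]
  exact glAct_one x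

theorem gaugeAt_mem (A : GaugeGroup T k) (t : Finset (Fin d)) :
    gaugeAt A t ∈ Matrix.orthogonalGroup (Fin (k t)) ℝ := by
  unfold gaugeAt
  split_ifs
  · exact (A _).2
  · exact one_mem _

theorem gaugeAt_mul_transpose (A : GaugeGroup T k) (t : Finset (Fin d)) :
    gaugeAt A t * (gaugeAt A t).transpose = 1 :=
  (Matrix.mem_orthogonalGroup_iff _ _).1 (gaugeAt_mem A t)

theorem gaugeAt_transpose_mul (A : GaugeGroup T k) (t : Finset (Fin d)) :
    (gaugeAt A t).transpose * gaugeAt A t = 1 :=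
  (Matrix.mem_orthogonalGroup_iff' _ _).1 (gaugeAt_mem A t)

theorem gaugeAt_nonRoot (A : GaugeGroup T k) (t : T.NonRoot) : gaugeAt A t.1.1 = (A t).1 :=
  dif_pos (NonRoot.isNonRoot t)

theorem gaugeAt_out (A : GaugeGroup T k) {t : Finset (Fin d)} (h : ¬ IsNonRoot T t) :
    gaugeAt A t = 1 := dif_neg h

theorem isUnit_det_gaugeAt_transpose (A : GaugeGroup T k) (t : Finset (Fin d)) :
    IsUnit ((gaugeAt A t).transpose).det :=
  Matrix.isUnit_det_of_right_inverse (gaugeAt_transpose_mul A t)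

theorem gaugeAct_eq_glAct (x : Param T k) (A : GaugeGroup T k) :
    gaugeAct x A = glAct (fun t => (gaugeAt A t).transpose) x := by
  funext t
  simp only [gaugeAct, glAct, Matrix.kroneckerMap_transpose,
    Matrix.inv_eq_right_inv (gaugeAt_transpose_mul A _)]

theorem mat1_kronecker {a b c : ℕ} (G : Matrix (Fin a) (Fin a) ℝ) (H : Matrix (Fin b) (Fin b) ℝ)
    (X : Tensor a b c) (K : Matrix (Fin c) (Fin c) ℝ) :
    mat1 ((G ⊗ₖ H) * X * K) = G * mat1 X * (H.transpose ⊗ₖ K) := by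
  ext i ⟨j, l⟩
  simp only [mat1, Matrix.of_apply, Matrix.mul_apply, Matrix.kroneckerMap_apply,
    Fintype.sum_prod_type, Finset.sum_mul, Matrix.transpose_apply]
  rw [Finset.sum_comm_cycle]
  exact Finset.sum_congr rfl fun _ _ => Finset.sum_congr rfl fun _ _ =>
    Finset.sum_congr rfl fun _ _ => by ring

theorem mat2_kronecker {a b c : ℕ} (G : Matrix (Fin a) (Fin a) ℝ) (H : Matrix (Fin b) (Fin b) ℝ)
    (X : Tensor a b c) (K : Matrix (Fin c) (Fin c) ℝ) :
    mat2 ((G ⊗ₖ H) * X * K) = H * mat2 X * (G.transpose ⊗ₖ K) := by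
  ext i ⟨j, l⟩
  simp only [mat2, Matrix.of_apply, Matrix.mul_apply, Matrix.kroneckerMap_apply,
    Fintype.sum_prod_type, Finset.sum_mul, Matrix.transpose_apply]
  rw [Finset.sum_comm]
  exact Finset.sum_congr rfl fun _ _ => Finset.sum_congr rfl fun _ _ =>
    Finset.sum_congr rfl fun _ _ => by ring

theorem isUnit_det_kronecker {a b : Type*} [Fintype a] [Fintype b] [DecidableEq a] [DecidableEq b]
    {G : Matrix a a ℝ} {H : Matrix b b ℝ}
    (hG : IsUnit G.det) (hH : IsUnit H.det) : IsUnit (G ⊗ₖ H).det := by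
  rw [Matrix.det_kronecker]
  exact (hG.pow _).mul (hH.pow _)

theorem rank_mul_mul {a b : Type*} [Fintype a] [Fintype b] [DecidableEq a] [DecidableEq b]
    {G : Matrix a a ℝ} {X : Matrix a b ℝ} {H : Matrix b b ℝ}
    (hG : IsUnit G.det) (hH : IsUnit H.det) : (G * X * H).rank = X.rank := by
  rw [Matrix.rank_mul_eq_left_of_isUnit_det _ _ hH, Matrix.rank_mul_eq_right_of_isUnit_det _ _ hG]

theorem isFullRank_glAct {G : Family k} (hG : ∀ t, IsUnit (G t).det) {x : Param T k} :
    IsFullRank T k (glAct G x) ↔ IsFullRank T k x := by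
  have hG' : ∀ t, IsUnit ((G t)⁻¹).det := fun t => by
    rw [Matrix.det_nonsing_inv]
    exact (hG t).ringInverse
  have hT : ∀ t, IsUnit (G t).transpose.det := fun t => by
    rw [Matrix.det_transpose]
    exact hG t
  simp only [IsFullRank, glAct, mat1_kronecker, mat2_kronecker]
  simp only [rank_mul_mul (isUnit_det_kronecker (hG _) (hG _)) (hG' _),
    rank_mul_mul (hG _) (isUnit_det_kronecker (hT _) (hG' _))]

theorem kronecker_transpose_mul_self {a b : Type*} [Fintype a] [Fintype b] [DecidableEq a]
    [DecidableEq b] {G : Matrix a a ℝ} {H : Matrix b b ℝ} (hG : G.transpose * G = 1)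
    (hH : H.transpose * H = 1) : (G ⊗ₖ H).transpose * (G ⊗ₖ H) = 1 := by
  rw [← Matrix.kroneckerMap_transpose, ← Matrix.mul_kronecker_mul, hG, hH, Matrix.one_kronecker_one]

theorem mul_mul_mem_stiefel {a b : Type*} [Fintype a] [Fintype b] [DecidableEq a] [DecidableEq b]
    {Q : Matrix a a ℝ} {X : Matrix a b ℝ} {W : Matrix b b ℝ} (hQ : Q.transpose * Q = 1)
    (hX : X ∈ stiefel a b) (hW : W.transpose * W = 1) : Q * X * W ∈ stiefel a b := by
  have hX' : X.transpose * X = 1 := hX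
  calc (Q * X * W).transpose * (Q * X * W)
      = W.transpose * (X.transpose * (Q.transpose * Q) * X) * W := by
        simp only [Matrix.transpose_mul, Matrix.mul_assoc]
    _ = 1 := by rw [hQ, Matrix.mul_one, hX', Matrix.mul_one, hW]

theorem gaugeFactor_transpose_mul_self (A : GaugeGroup T k) (s t : Finset (Fin d)) :
    ((gaugeAt A s ⊗ₖ gaugeAt A t).transpose).transpose * (gaugeAt A s ⊗ₖ gaugeAt A t).transpose
      = 1 := by
  rw [← Matrix.kroneckerMap_transpose]
  exact kronecker_transpose_mul_self
    (by rw [Matrix.transpose_transpose]; exact gaugeAt_mul_transpose A _)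
    (by rw [Matrix.transpose_transpose]; exact gaugeAt_mul_transpose A _)

theorem gaugeAct_mem {x : Param T k} (hx : x ∈ orthTTN T k) (A : GaugeGroup T k) :
    gaugeAct x A ∈ orthTTN T k := by
  constructor
  · rw [gaugeAct_eq_glAct]
    exact (isFullRank_glAct (isUnit_det_gaugeAt_transpose A)).2 hx.1
  · intro t
    exact mul_mul_mem_stiefel (gaugeFactor_transpose_mul_self A _ _) (hx.2 t)
      (gaugeAt_transpose_mul A _)

end Tree

/-! ### Normal forms and orthonormalization -/

section NormalForm

variable {d : ℕ} {T : DimensionTree d} {k : Finset (Fin d) → ℕ}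

/-- Two orthogonal parameters that differ by an invertible change of bases differ by an orthogonal
one: orthogonality of the matrices propagates from the leaves towards the root. -/
theorem exists_gauge {x y : Param T k} (hx : x ∈ orthTTN T k) (hy : y ∈ orthTTN T k)
    {G : Family k} (hG : ∀ t, IsUnit (G t).det) (hout : ∀ t, ¬ IsNonRoot T t → G t = 1)
    (h : y = glAct G x) : ∃ A : GaugeGroup T k, y = gaugeAct x A := by
  have horth : ∀ t, (G t).transpose * G t = 1 := by
    refine nodeInduction (T := T) (fun t ht => by rw [hout t ht]; simp) fun t hL hR => ?_
    have h1 : (x t.1).transpose * x t.1 = 1 := hx.2 t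
    have h2 : (y t.1).transpose * y t.1 = 1 := hy.2 t
    have h3 := kronecker_transpose_mul_self hL hR
    have h4 : ((G t.1.1)⁻¹).transpose * (G t.1.1)⁻¹ = 1 := by
      rw [h] at h2
      calc ((G t.1.1)⁻¹).transpose * (G t.1.1)⁻¹
          = ((G t.1.1)⁻¹).transpose * ((x t.1).transpose *
            ((G (T.left t.1.1) ⊗ₖ G (T.right t.1.1)).transpose *
              (G (T.left t.1.1) ⊗ₖ G (T.right t.1.1))) * x t.1) * (G t.1.1)⁻¹ := by
            rw [h3, Matrix.mul_one, h1, Matrix.mul_one]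
        _ = 1 := by
            rw [← h2]
            simp only [glAct, Matrix.transpose_mul, Matrix.mul_assoc]
    have h5 : (G t.1.1)⁻¹ * ((G t.1.1)⁻¹).transpose = 1 := mul_eq_one_comm.1 h4
    have h6 : ((G t.1.1)⁻¹).transpose = G t.1.1 := by
      rw [← Matrix.inv_eq_right_inv h5, Matrix.nonsing_inv_nonsing_inv _ (hG _)]
    have h7 : (G t.1.1).transpose = (G t.1.1)⁻¹ := by
      rw [← h6, Matrix.transpose_transpose, h6]
    rw [h7, Matrix.nonsing_inv_mul _ (hG _)]
  refine ⟨fun t => ⟨(G t.1.1).transpose, (Matrix.mem_orthogonalGroup_iff _ _).2 ?_⟩, ?_⟩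
  · rw [Matrix.transpose_transpose]
    exact horth _
  · rw [h, gaugeAct_eq_glAct]
    congr 1
    funext t
    by_cases ht : IsNonRoot T t
    · have := gaugeAt_nonRoot (T := T) (k := k) (fun t => ⟨(G t.1.1).transpose,
        (Matrix.mem_orthogonalGroup_iff _ _).2 (by
          rw [Matrix.transpose_transpose]
          exact horth _)⟩) ⟨⟨t, ht.1⟩, ht.2⟩
      rw [this, Matrix.transpose_transpose]
    · rw [gaugeAt_out _ ht, hout t ht, Matrix.transpose_one]

/-- The family `M_t = B⁰_tᵀ (M_{t_L} ⊗ M_{t_R}) B_t`, which brings `x = (B_t)` into normal form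
with respect to `x₀ = (B⁰_t)`. -/
noncomputable def normFamily (x₀ x : Param T k) : Family k :=
  treeRec fun t L R => (x₀ t.1).transpose * (L ⊗ₖ R) * x t.1

/-- The representative `C` of the orbit of `x` under changes of bases with `B⁰_tᵀ C_t = 1`. -/
noncomputable def normalForm (x₀ x : Param T k) : Param T k := glAct (normFamily x₀ x) x

theorem normFamily_nonRoot (x₀ x : Param T k) (t : T.NonRoot) :
    normFamily x₀ x t.1.1 = (x₀ t.1).transpose *
      (normFamily x₀ x (T.left t.1.1) ⊗ₖ normFamily x₀ x (T.right t.1.1)) * x t.1 :=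
  treeRec_nonRoot _ t

theorem normFamily_out (x₀ x : Param T k) {t : Finset (Fin d)} (h : ¬ IsNonRoot T t) :
    normFamily x₀ x t = 1 := treeRec_out _ h

/-- Equivariance of the normalizing family; with `normalForm_glAct`, normal forms are invariant. -/
theorem normFamily_glAct (x₀ x : Param T k) {G : Family k} (hG : ∀ t, IsUnit (G t).det)
    (hout : ∀ t, ¬ IsNonRoot T t → G t = 1) (t : Finset (Fin d)) :
    normFamily x₀ (glAct G x) t = normFamily x₀ x t * (G t)⁻¹ := by
  revert t
  refine nodeInduction (T := T) (fun t ht => ?_) fun t hL hR => ?_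
  · rw [normFamily_out _ _ ht, normFamily_out _ _ ht, hout t ht, inv_one, Matrix.mul_one]
  · rw [normFamily_nonRoot, hL, hR, normFamily_nonRoot, glAct, Matrix.mul_kronecker_mul]
    have : ((G (T.left t.1.1))⁻¹ ⊗ₖ (G (T.right t.1.1))⁻¹) *
        (G (T.left t.1.1) ⊗ₖ G (T.right t.1.1)) = 1 := by
      rw [← Matrix.mul_kronecker_mul, Matrix.nonsing_inv_mul _ (hG _),
        Matrix.nonsing_inv_mul _ (hG _), Matrix.one_kronecker_one]
    calc _ = (x₀ t.1).transpose * (normFamily x₀ x (T.left t.1.1) ⊗ₖ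
          normFamily x₀ x (T.right t.1.1)) * (((G (T.left t.1.1))⁻¹ ⊗ₖ (G (T.right t.1.1))⁻¹) *
            (G (T.left t.1.1) ⊗ₖ G (T.right t.1.1))) * x t.1 * (G t.1.1)⁻¹ := by
          simp only [Matrix.mul_assoc]
      _ = _ := by rw [this, Matrix.mul_one]

theorem normalForm_glAct (x₀ x : Param T k) {G : Family k} (hG : ∀ t, IsUnit (G t).det)
    (hout : ∀ t, ¬ IsNonRoot T t → G t = 1) :
    normalForm x₀ (glAct G x) = normalForm x₀ x := by
  rw [normalForm, glAct_glAct, normalForm]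
  congr 1
  funext t
  rw [normFamily_glAct x₀ x hG hout, Matrix.mul_assoc, Matrix.nonsing_inv_mul _ (hG t),
    Matrix.mul_one]

theorem transpose_mul_normalForm {x₀ x : Param T k} (h : ∀ t, IsUnit (normFamily x₀ x t).det)
    (t : T.NonRoot) : (x₀ t.1).transpose * normalForm x₀ x t.1 = 1 := by
  rw [normalForm, glAct, ← Matrix.mul_assoc, ← Matrix.mul_assoc, ← normFamily_nonRoot]
  exact Matrix.mul_nonsing_inv _ (h _)

theorem normFamily_eq_one {x₀ x : Param T k} (h : ∀ t : T.NonRoot, (x₀ t.1).transpose * x t.1 = 1)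
    (t : Finset (Fin d)) : normFamily x₀ x t = 1 := by
  revert t
  refine nodeInduction (T := T) (fun t ht => normFamily_out _ _ ht) fun t hL hR => ?_
  rw [normFamily_nonRoot, hL, hR, Matrix.one_kronecker_one, Matrix.mul_one, h]

theorem normalForm_eq_self {x₀ x : Param T k}
    (h : ∀ t : T.NonRoot, (x₀ t.1).transpose * x t.1 = 1) : normalForm x₀ x = x := by
  rw [normalForm, show normFamily x₀ x = fun _ => 1 from funext (normFamily_eq_one h), glAct_one]

/-- The family `N_t = (Y_tᵀ Y_t)^(1/2)`, `Y_t = (N_{t_L} ⊗ N_{t_R}) C_t`, which orthonormalizes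
`(C_t)`. -/
noncomputable def orthFamily (C : Param T k) : Family k :=
  treeRec fun t L R => psqrt (((L ⊗ₖ R) * C t.1).transpose * ((L ⊗ₖ R) * C t.1))

theorem orthFamily_nonRoot (C : Param T k) (t : T.NonRoot) :
    orthFamily C t.1.1 = psqrt
      (((orthFamily C (T.left t.1.1) ⊗ₖ orthFamily C (T.right t.1.1)) * C t.1).transpose *
        ((orthFamily C (T.left t.1.1) ⊗ₖ orthFamily C (T.right t.1.1)) * C t.1)) :=
  treeRec_nonRoot _ t

theorem orthFamily_out (C : Param T k) {t : Finset (Fin d)} (h : ¬ IsNonRoot T t) :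
    orthFamily C t = 1 := treeRec_out _ h

theorem posDef_transpose_mul_self {a b : Type*} [Fintype a] [Fintype b] {Y : Matrix a b ℝ}
    (h : Function.Injective Y.mulVec) : (Y.transpose * Y).PosDef := by
  simpa using Matrix.PosDef.conjTranspose_mul_self Y h

theorem injective_mul_mulVec {a b : Type*} [Fintype a] [Fintype b] [DecidableEq a]
    {K : Matrix a a ℝ} {Y : Matrix a b ℝ} (hK : IsUnit K.det)
    (h : Function.Injective Y.mulVec) : Function.Injective (K * Y).mulVec := by
  have hK' := Matrix.mulVec_injective_of_isUnit ((Matrix.isUnit_iff_isUnit_det K).2 hK)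
  intro v w hvw
  simp only [← Matrix.mulVec_mulVec] at hvw
  exact h (hK' hvw)

theorem isUnit_det_orthFamily {C : Param T k}
    (hC : ∀ t : T.NonRoot, Function.Injective (C t.1).mulVec) (t : Finset (Fin d)) :
    IsUnit (orthFamily C t).det := by
  revert t
  refine nodeInduction (T := T) (fun t ht => ?_) fun t hL hR => ?_
  · rw [orthFamily_out _ ht, Matrix.det_one]
    exact isUnit_one
  · rw [orthFamily_nonRoot]
    exact isUnit_det_psqrt (posDef_transpose_mul_self
      (injective_mul_mulVec (isUnit_det_kronecker hL hR) (hC t)))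

theorem glAct_orthFamily_mem {C : Param T k}
    (hC : ∀ t : T.NonRoot, Function.Injective (C t.1).mulVec) (hr : IsFullRank T k C) :
    glAct (orthFamily C) C ∈ orthTTN T k := by
  have hu := isUnit_det_orthFamily hC
  refine ⟨(isFullRank_glAct hu).2 hr, fun t => ?_⟩
  set Y := (orthFamily C (T.left t.1.1) ⊗ₖ orthFamily C (T.right t.1.1)) * C t.1 with hY
  have hP : (Y.transpose * Y).PosDef := posDef_transpose_mul_self
    (injective_mul_mulVec (isUnit_det_kronecker (hu _) (hu _)) (hC t))
  have hN : orthFamily C t.1.1 = psqrt (Y.transpose * Y) := orthFamily_nonRoot C t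
  have hS := isUnit_det_psqrt hP
  have h1 : glAct (orthFamily C) C t.1 = Y * (psqrt (Y.transpose * Y))⁻¹ := by
    rw [← hN, hY, glAct]
  change (glAct (orthFamily C) C t.1).transpose * glAct (orthFamily C) C t.1 = 1
  rw [h1]
  have h2 := psqrt_mul_self hP.posSemidef
  have h3 := psqrt_transpose (Y.transpose * Y)
  generalize psqrt (Y.transpose * Y) = S at *
  rw [Matrix.transpose_mul, Matrix.transpose_nonsing_inv, h3, Matrix.mul_assoc,
    ← Matrix.mul_assoc Y.transpose, ← h2, Matrix.mul_assoc S, Matrix.mul_nonsing_inv _ hS,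
    Matrix.mul_one, Matrix.nonsing_inv_mul _ hS]

section Smooth

variable {E : Type*} [NormedAddCommGroup E] [NormedSpace ℝ E] {s : Set E} {e : E}

theorem contDiffWithinAt_param {f : E → Param T k} :
    ContDiffWithinAt ℝ ∞ f s e ↔ ∀ t, ContDiffWithinAt ℝ ∞ (fun y => f y t) s e :=
  contDiffWithinAt_pi

theorem contDiffWithinAt_glAct {G : E → Family k} {f : E → Param T k}
    (hG : ∀ t, ContDiffWithinAt ℝ ∞ (fun y => G y t) s e) (hf : ContDiffWithinAt ℝ ∞ f s e)
    (hu : ∀ t, IsUnit (G e t).det) :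
    ContDiffWithinAt ℝ ∞ (fun y => glAct (G y) (f y)) s e := by
  rw [contDiffWithinAt_param] at hf ⊢
  intro t
  exact (((hG _).matrix_kronecker (hG _)).matrix_mul (hf t)).matrix_mul ((hG _).matrix_inv (hu _))

theorem contDiffWithinAt_normFamily (x₀ : Param T k) {f : E → Param T k}
    (hf : ContDiffWithinAt ℝ ∞ f s e) (t : Finset (Fin d)) :
    ContDiffWithinAt ℝ ∞ (fun y => normFamily x₀ (f y) t) s e := by
  rw [contDiffWithinAt_param] at hf
  revert t
  refine nodeInduction (T := T) (fun t ht => ?_) fun t hL hR => ?_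
  · simp only [normFamily_out _ _ ht]
    exact contDiffWithinAt_const
  · simp only [normFamily_nonRoot]
    exact (contDiffWithinAt_const.matrix_mul (hL.matrix_kronecker hR)).matrix_mul (hf t.1)

theorem contDiffWithinAt_orthFamily {f : E → Param T k} (hf : ContDiffWithinAt ℝ ∞ f s e)
    (hC : ∀ t : T.NonRoot, Function.Injective (f e t.1).mulVec) (t : Finset (Fin d)) :
    ContDiffWithinAt ℝ ∞ (fun y => orthFamily (f y) t) s e := by
  rw [contDiffWithinAt_param] at hf
  revert t
  refine nodeInduction (T := T) (fun t ht => ?_) fun t hL hR => ?_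
  · simp only [orthFamily_out _ ht]
    exact contDiffWithinAt_const
  · simp only [orthFamily_nonRoot]
    have hY := (hL.matrix_kronecker hR).matrix_mul (hf t.1)
    refine (contDiffWithinAt_psqrt (posDef_transpose_mul_self (injective_mul_mulVec
      (isUnit_det_kronecker (isUnit_det_orthFamily hC _) (isUnit_det_orthFamily hC _))
      (hC t)))).comp e (hY.matrix_transpose.matrix_mul hY) fun y _ => ?_
    simp only [Set.mem_ofPred_eq, Matrix.IsHermitian,
      Matrix.conjTranspose_eq_transpose_of_trivial, Matrix.transpose_mul,
      Matrix.transpose_transpose]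

end Smooth

/-- All the ranks in question are required to be maximal, so the conditions are lower bounds. -/
theorem isOpen_isFullRank : IsOpen {x : Param T k | IsFullRank T k x} := by
  have h1 : ∀ t : T.NonRoot, IsOpen {x : Param T k | (x t.1).rank = k t.1.1} := fun t => by
    have := (isOpen_le_rank (m := Fin (k (T.left t.1.1)) × Fin (k (T.right t.1.1)))
      (n := Fin (k t.1.1)) (k t.1.1)).preimage
      (continuous_apply t.1 : Continuous fun x : Param T k => x t.1)
    convert this using 1
    ext x
    refine ⟨fun h => h.ge, fun h => le_antisymm ?_ h⟩
    simpa using (x t.1).rank_le_card_width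
  have h2 : ∀ {a b : ℕ} {n : Type} [Fintype n] (_ : Fintype.card n = b)
      (f : Param T k → Matrix (Fin a) n ℝ), Continuous f → IsOpen {x | (f x).rank = min a b} := by
    intro a b n _ hb f hf
    convert (isOpen_le_rank (min a b)).preimage hf using 1
    ext x
    refine ⟨fun h => h.ge, fun h => le_antisymm (le_min ?_ ?_) h⟩
    · simpa using (f x).rank_le_card_height
    · simpa [hb] using (f x).rank_le_card_width
  have h3 : ∀ t : T.Internal, Continuous fun x : Param T k => mat1 (x t) := fun t =>
    continuous_matrix fun _ _ =>
      Continuous.matrix_elem (A := fun x : Param T k => x t) (continuous_apply t) _ _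
  have h4 : ∀ t : T.Internal, Continuous fun x : Param T k => mat2 (x t) := fun t =>
    continuous_matrix fun _ _ =>
      Continuous.matrix_elem (A := fun x : Param T k => x t) (continuous_apply t) _ _
  simp only [IsFullRank, Set.ofPred_and, Set.ofPred_forall]
  refine (isOpen_iInter_of_finite h1).inter (isOpen_iInter_of_finite fun t =>
    isOpen_iInter_of_finite fun _ => (h2 (by simp) _ (h3 t)).inter (h2 (by simp) _ (h4 t)))

variable (T k) in
/-- The linear map `Z ↦ (B⁰_tᵀ Z_t)`, whose kernel parametrizes the normal forms. -/
def sliceMap (x₀ : Param T k) :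
    Param T k →ₗ[ℝ] (∀ t : T.NonRoot, Matrix (Fin (k t.1.1)) (Fin (k t.1.1)) ℝ) where
  toFun Z t := (x₀ t.1).transpose * Z t.1
  map_add' Z Z' := by funext t; simp [Matrix.mul_add]
  map_smul' c Z := by funext t; simp

variable (T k) in
/-- The dimension of the quotient `𝒯/𝒢`. -/
noncomputable def quotDim : ℕ :=
  Module.finrank ℝ (Param T k) -
    Module.finrank ℝ (∀ t : T.NonRoot, Matrix (Fin (k t.1.1)) (Fin (k t.1.1)) ℝ)

theorem finrank_ker_sliceMap {x₀ : Param T k} (h : x₀ ∈ orthTTN T k) :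
    Module.finrank ℝ (LinearMap.ker (sliceMap T k x₀)) = quotDim T k := by
  classical
  have hs : Function.Surjective (sliceMap T k x₀) := by
    intro Y
    refine ⟨fun t => if ht : t.1 ≠ Finset.univ then x₀ t * Y ⟨t, ht⟩ else 0, ?_⟩
    funext t
    have h1 : (x₀ t.1).transpose * x₀ t.1 = 1 := h.2 t
    simp only [sliceMap, LinearMap.coe_mk, AddHom.coe_mk]
    rw [dif_pos t.2, ← Matrix.mul_assoc, h1, Matrix.one_mul]
  have h1 := LinearMap.finrank_range_add_finrank_ker (sliceMap T k x₀)
  rw [LinearMap.range_eq_top.2 hs, finrank_top] at h1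
  unfold quotDim
  omega

/-- Linear coordinates on the kernel of `sliceMap`: a parametrization `ι` and a left inverse `ρ`. -/
theorem exists_sliceCoordinates {x₀ : Param T k} (h : x₀ ∈ orthTTN T k) :
    ∃ (ι : EuclideanSpace ℝ (Fin (quotDim T k)) →L[ℝ] Param T k)
      (ρ : Param T k →L[ℝ] EuclideanSpace ℝ (Fin (quotDim T k))),
      (∀ z, ρ (ι z) = z) ∧ (∀ z (t : T.NonRoot), (x₀ t.1).transpose * ι z t.1 = 0) ∧
      ∀ Z : Param T k, (∀ t : T.NonRoot, (x₀ t.1).transpose * Z t.1 = 0) → ι (ρ Z) = Z := by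
  let e : EuclideanSpace ℝ (Fin (quotDim T k)) ≃ₗ[ℝ] LinearMap.ker (sliceMap T k x₀) :=
    LinearEquiv.ofFinrankEq _ _ (by simp [finrank_ker_sliceMap h])
  obtain ⟨p, hp⟩ := LinearMap.exists_leftInverse_of_injective
    (LinearMap.ker (sliceMap T k x₀)).subtype (Submodule.ker_subtype _)
  have hp' : ∀ Z : LinearMap.ker (sliceMap T k x₀), p Z = Z := fun Z => LinearMap.congr_fun hp Z
  refine ⟨LinearMap.toContinuousLinearMap
      ((LinearMap.ker (sliceMap T k x₀)).subtype.comp e.toLinearMap),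
    LinearMap.toContinuousLinearMap (e.symm.toLinearMap.comp p), ?_, ?_, ?_⟩
  · intro z
    simp [hp']
  · intro z t
    exact congr_fun (LinearMap.mem_ker.1 (e z).2) t
  · intro Z hZ
    have := hp' ⟨Z, LinearMap.mem_ker.2 (funext hZ)⟩
    simp only [LinearMap.coe_toContinuousLinearMap', LinearMap.comp_apply, LinearEquiv.coe_coe,
      Submodule.subtype_apply] at this ⊢
    rw [this, LinearEquiv.apply_symm_apply]

end NormalForm

/-! ### Charts of quotients from slices, and velocities in charts -/

section SliceCharts

variable {E : Type*} [NormedAddCommGroup E] [NormedSpace ℝ E]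
  {F : Type*} [NormedAddCommGroup F] [NormedSpace ℝ F] {S : Set E}

/-- The topology on `S` is a parameter, which is only required to be propositionally equal to the
subspace topology: the topologies of spaces of matrices and of normed spaces of matrices agree only
after unfolding. -/
class HasSubspaceTopology (S : Set E) [TopologicalSpace S] : Prop where
  isInducing : Topology.IsInducing (Subtype.val : S → E)

/-- A chart of the quotient of `S ⊆ E` by an equivalence relation, presented upstairs: a smooth map
`toFun` on an open subset `dom` of `E` whose fibres in `S` are equivalence classes, and which has a
local smooth section with values in `S` through each point of `S ∩ dom`. The point `center` only
serves to have a default value. -/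
structure SliceChart (r : Setoid S) (F : Type*) [NormedAddCommGroup F] [NormedSpace ℝ F] where
  center : S
  dom : Set E
  toFun : E → F
  isOpen_dom : IsOpen dom
  contDiffOn_toFun : ContDiffOn ℝ ∞ toFun dom
  saturated : ∀ x y : S, r x y → x.1 ∈ dom → y.1 ∈ dom ∧ toFun y = toFun x
  separates : ∀ x y : S, x.1 ∈ dom → y.1 ∈ dom → toFun x = toFun y → r x y
  exists_section : ∀ x : S, x.1 ∈ dom → ∃ (W : Set F) (σ : F → E), IsOpen W ∧ toFun x ∈ W ∧
    ContDiffOn ℝ ∞ σ W ∧ σ (toFun x) = x ∧ ∀ z ∈ W, σ z ∈ S ∧ σ z ∈ dom ∧ toFun (σ z) = z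

namespace SliceChart

variable {r : Setoid S} (c : SliceChart r F)

open scoped Classical in
/-- The inverse of the chart that a slice chart induces on the quotient. -/
noncomputable def invFun (z : F) : Quotient r :=
  if h : ∃ x : S, x.1 ∈ c.dom ∧ c.toFun x = z then Quotient.mk r h.choose
  else Quotient.mk r c.center

theorem invFun_toFun {x : S} (hx : x.1 ∈ c.dom) : c.invFun (c.toFun x) = Quotient.mk r x := by
  have h : ∃ y : S, y.1 ∈ c.dom ∧ c.toFun y = c.toFun x := ⟨x, hx, rfl⟩
  rw [invFun, dif_pos h]
  exact Quotient.sound (c.separates _ _ h.choose_spec.1 hx h.choose_spec.2)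

theorem mem_dom_out {x : S} (hx : x.1 ∈ c.dom) :
    (Quotient.mk r x).out.1 ∈ c.dom ∧ c.toFun (Quotient.mk r x).out = c.toFun x :=
  c.saturated _ _ (r.symm (Quotient.mk_out x)) hx

variable [TopologicalSpace S] [hS : HasSubspaceTopology S]

/-- The chart that a slice chart induces on the quotient. -/
noncomputable def chart : OpenPartialHomeomorph (Quotient r) F where
  toFun q := c.toFun q.out
  invFun := c.invFun
  source := {q | q.out.1 ∈ c.dom}
  target := {z | ∃ x : S, x.1 ∈ c.dom ∧ c.toFun x = z}
  map_source' q hq := ⟨q.out, hq, rfl⟩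
  map_target' := by
    rintro z ⟨x, hx, rfl⟩
    rw [c.invFun_toFun hx]
    exact (c.mem_dom_out hx).1
  left_inv' q hq := by rw [c.invFun_toFun hq, Quotient.out_eq]
  right_inv' := by
    rintro z ⟨x, hx, rfl⟩
    rw [c.invFun_toFun hx]
    exact (c.mem_dom_out hx).2
  open_source := by
    refine isOpen_coinduced.2 ?_
    convert c.isOpen_dom.preimage hS.isInducing.continuous using 1
    ext x
    exact ⟨fun h => (c.saturated _ _ (Quotient.mk_out x) h).1, fun h => (c.mem_dom_out h).1⟩
  open_target := by
    refine isOpen_iff_mem_nhds.2 ?_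
    rintro z ⟨x, hx, rfl⟩
    obtain ⟨W, σ, hW, hxW, -, -, hσ⟩ := c.exists_section x hx
    filter_upwards [hW.mem_nhds hxW] with z hz
    exact ⟨⟨σ z, (hσ z hz).1⟩, (hσ z hz).2.1, (hσ z hz).2.2⟩
  continuousOn_toFun := by
    have hopen : IsOpen {q : Quotient r | q.out.1 ∈ c.dom} := by
      refine isOpen_coinduced.2 ?_
      convert c.isOpen_dom.preimage hS.isInducing.continuous using 1
      ext x
      exact ⟨fun h => (c.saturated _ _ (Quotient.mk_out x) h).1, fun h => (c.mem_dom_out h).1⟩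
    rw [continuousOn_open_iff hopen]
    intro V hV
    refine isOpen_coinduced.2 ?_
    have h1 := c.contDiffOn_toFun.continuousOn.isOpen_inter_preimage c.isOpen_dom hV
    convert h1.preimage hS.isInducing.continuous using 1
    ext x
    constructor
    · rintro ⟨h, h'⟩
      obtain ⟨h2, h3⟩ := c.saturated _ _ (Quotient.mk_out x) h
      refine ⟨h2, ?_⟩
      change c.toFun x ∈ V
      rw [h3]
      exact h'
    · rintro ⟨h, h'⟩
      obtain ⟨h2, h3⟩ := c.mem_dom_out h
      refine ⟨h2, ?_⟩
      change c.toFun (Quotient.mk r x).out ∈ V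
      rw [h3]
      exact h'
  continuousOn_invFun := by
    rintro z ⟨x, hx, rfl⟩
    obtain ⟨W, σ, hW, hxW, hσc, -, hσ⟩ := c.exists_section x hx
    refine ContinuousAt.continuousWithinAt ?_
    have h1 : Continuous fun z : W => (⟨σ z, (hσ z z.2).1⟩ : S) :=
      hS.isInducing.continuous_iff.2 (continuousOn_iff_continuous_domRestrict.1 hσc.continuousOn)
    have h2 : Continuous fun z : W => Quotient.mk r (⟨σ z, (hσ z z.2).1⟩ : S) :=
      continuous_quotient_mk'.comp h1
    have h3 : ContinuousOn c.invFun W := by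
      rw [continuousOn_iff_continuous_domRestrict]
      convert h2 using 1
      funext z
      have := c.invFun_toFun (x := ⟨σ z, (hσ z z.2).1⟩) (hσ z z.2).2.1
      rw [← this]
      exact congrArg c.invFun (hσ z z.2).2.2.symm
    exact h3.continuousAt (hW.mem_nhds hxW)

theorem mk_mem_source {x : S} : Quotient.mk r x ∈ c.chart.source ↔ x.1 ∈ c.dom :=
  ⟨fun h => (c.saturated _ _ (Quotient.mk_out x) h).1, fun h => (c.mem_dom_out h).1⟩

theorem chart_mk {x : S} (hx : x.1 ∈ c.dom) : c.chart (Quotient.mk r x) = c.toFun x :=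
  (c.mem_dom_out hx).2

theorem chart_symm_toFun {x : S} (hx : x.1 ∈ c.dom) :
    c.chart.symm (c.toFun x) = Quotient.mk r x := c.invFun_toFun hx

theorem toFun_mem_target {x : S} (hx : x.1 ∈ c.dom) : c.toFun x ∈ c.chart.target := ⟨x, hx, rfl⟩

/-- The change of coordinates between two slice charts is smooth: locally it is one of them after
a section of the other. -/
theorem contDiffOn_chart_symm_trans (c c' : SliceChart r F) :
    ContDiffOn ℝ ∞ (c'.chart ∘ c.chart.symm) (c.chart.symm.trans c'.chart).source := by
  intro z hz
  rw [OpenPartialHomeomorph.trans_source] at hz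
  obtain ⟨⟨x, hx, rfl⟩, hz2⟩ := hz
  rw [Set.mem_preimage, c.chart_symm_toFun hx, mk_mem_source] at hz2
  obtain ⟨W, σ, hW, hxW, hσc, hσx, hσ⟩ := c.exists_section x hx
  have h1 : ContDiffAt ℝ ∞ σ (c.toFun x) := hσc.contDiffAt (hW.mem_nhds hxW)
  have h2 : ContDiffAt ℝ ∞ c'.toFun (σ (c.toFun x)) := by
    rw [hσx]
    exact c'.contDiffOn_toFun.contDiffAt (c'.isOpen_dom.mem_nhds hz2)
  refine ((h2.comp _ h1).congr_of_eventuallyEq ?_).contDiffWithinAt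
  have h3 : ∀ᶠ z in 𝓝 (c.toFun x), σ z ∈ c'.dom :=
    h1.continuousAt.eventually (by rw [hσx]; exact c'.isOpen_dom.mem_nhds hz2)
  filter_upwards [hW.mem_nhds hxW, h3] with z hzW hz3
  have h4 := c.chart_symm_toFun (x := ⟨σ z, (hσ z hzW).1⟩) (hσ z hzW).2.1
  simp only [(hσ z hzW).2.2] at h4
  rw [Function.comp_apply, h4, c'.chart_mk (x := ⟨σ z, (hσ z hzW).1⟩) hz3]
  rfl

variable (cs : S → SliceChart r F) (hcs : ∀ x : S, x.1 ∈ (cs x).dom)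

/-- The charts on the quotient that are induced by a family of slice charts. -/
@[reducible] noncomputable def chartedSpace : ChartedSpace F (Quotient r) where
  atlas := Set.range fun x => (cs x).chart
  chartAt q := (cs q.out).chart
  mem_chart_source q := hcs q.out
  chart_mem_atlas q := ⟨q.out, rfl⟩

theorem isManifold :
    letI := chartedSpace cs hcs
    IsManifold 𝓘(ℝ, F) ∞ (Quotient r) := by
  let _ := chartedSpace cs hcs
  refine isManifold_of_contDiffOn 𝓘(ℝ, F) ∞ _ ?_
  rintro _ _ ⟨x, rfl⟩ ⟨y, rfl⟩
  have := contDiffOn_chart_symm_trans (cs x) (cs y)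
  simpa using this

end SliceChart

end SliceCharts

section Velocity

variable {F : Type*} [NormedAddCommGroup F] [NormedSpace ℝ F]
  {N : Type*} [TopologicalSpace N] [ChartedSpace F N]

/-- The fibre coordinate of a tangent vector of a manifold in the chart `e`. -/
noncomputable def tcoord (e : OpenPartialHomeomorph N F) (p : TangentBundle 𝓘(ℝ, F) N) : F :=
  (tangentMap 𝓘(ℝ, F) 𝓘(ℝ, F) e p).2

theorem tcoord_smul (e : OpenPartialHomeomorph N F) (q : N) (s : ℝ) (v : TangentSpace 𝓘(ℝ, F) q) :
    tcoord e ⟨q, s • v⟩ = s • tcoord e ⟨q, v⟩ :=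
  (mfderiv 𝓘(ℝ, F) 𝓘(ℝ, F) e q).map_smul s v

theorem tcoord_zero (e : OpenPartialHomeomorph N F) (q : N) : tcoord e (⟨q, 0⟩ : TangentBundle 𝓘(ℝ, F) N) = 0 :=
  (mfderiv 𝓘(ℝ, F) 𝓘(ℝ, F) e q).map_zero

variable [IsManifold 𝓘(ℝ, F) ∞ N] {e : OpenPartialHomeomorph N F}

theorem tcoord_injective (he : e ∈ atlas F N) {p p' : TangentBundle 𝓘(ℝ, F) N}
    (hp : p.1 ∈ e.source) (h1 : p.1 = p'.1) (h2 : tcoord e p = tcoord e p') : p = p' := by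
  obtain ⟨q, v⟩ := p
  obtain ⟨q', v'⟩ := p'
  obtain rfl : q = q' := h1
  congr 1
  exact (mdifferentiable_of_mem_atlas (I := 𝓘(ℝ, F)) he).mfderiv_injective hp h2

/-- The velocity of a curve may be computed in any chart. -/
theorem hasVelocity_iff (he : e ∈ atlas F N) {γ : ℝ → N} {f : ℝ → F} {w : F}
    (hγ : ∀ᶠ s in 𝓝 (0 : ℝ), γ s ∈ e.source ∧ e (γ s) = f s) (hf : HasDerivAt f w 0)
    (p : TangentBundle 𝓘(ℝ, F) N) :
    HasVelocity 𝓘(ℝ, F) γ p ↔ p.1 = γ 0 ∧ tcoord e p = w := by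
  have hem := mdifferentiable_of_mem_atlas (I := 𝓘(ℝ, F)) he
  have h0 := hγ.self_of_nhds
  have hdiff : MDifferentiableAt 𝓘(ℝ, ℝ) 𝓘(ℝ, F) γ 0 := by
    have h1 : MDifferentiableAt 𝓘(ℝ, F) 𝓘(ℝ, F) e.symm (f 0) :=
      hem.mdifferentiableAt_symm (h0.2 ▸ e.map_source h0.1)
    refine (h1.comp (0 : ℝ) hf.differentiableAt.mdifferentiableAt).congr_of_eventuallyEq ?_
    filter_upwards [hγ] with s hs
    rw [Function.comp_apply, ← hs.2, e.left_inv hs.1]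
  set p' := tangentMap 𝓘(ℝ, ℝ) 𝓘(ℝ, F) γ (⟨0, (1 : ℝ)⟩ : TangentBundle 𝓘(ℝ, ℝ) ℝ) with hp'
  have hw : tcoord e p' = w := by
    have h2 : mfderiv 𝓘(ℝ, ℝ) 𝓘(ℝ, F) (e ∘ γ) 0 = (mfderiv 𝓘(ℝ, F) 𝓘(ℝ, F) e (γ 0)).comp
        (mfderiv 𝓘(ℝ, ℝ) 𝓘(ℝ, F) γ 0) := mfderiv_comp 0 (hem.mdifferentiableAt h0.1) hdiff
    have h3 : HasDerivAt (e ∘ γ) w 0 := hf.congr_of_eventuallyEq (hγ.mono fun s hs => hs.2)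
    have h4 : mfderiv 𝓘(ℝ, ℝ) 𝓘(ℝ, F) (e ∘ γ) 0 (1 : ℝ) = w := by
      rw [mfderiv_eq_fderiv]
      exact h3.deriv
    rw [h2] at h4
    exact h4
  constructor
  · rintro ⟨-, h⟩
    rw [← h]
    exact ⟨rfl, hw⟩
  · rintro ⟨h1, h2⟩
    exact ⟨hdiff, (tcoord_injective he (by rw [h1]; exact h0.1) h1 (h2.trans hw.symm)).symm⟩

theorem contMDiffOn_tcoord (he : e ∈ atlas F N) :
    ContMDiffOn 𝓘(ℝ, F).tangent 𝓘(ℝ, F) ∞ (tcoord e : TangentBundle 𝓘(ℝ, F) N → F)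
      {p | p.1 ∈ e.source} := by
  have h1 : ContMDiffOn 𝓘(ℝ, F) 𝓘(ℝ, F) ∞ e e.source := contMDiffOn_of_mem_maximalAtlas
    (IsManifold.subset_maximalAtlas he)
  have h2 := h1.contMDiffOn_tangentMapWithin (m := ∞) (by simp) e.open_source.uniqueMDiffOn
  have h3 := (contMDiff_snd_tangentBundle_modelSpace (n := ∞) F 𝓘(ℝ, F)).comp_contMDiffOn h2
  refine h3.congr fun p hp => ?_
  have h4 := tangentMapWithin_eq_tangentMap (e.open_source.uniqueMDiffOn _ hp)
    ((mdifferentiable_of_mem_atlas (I := 𝓘(ℝ, F)) he).mdifferentiableAt hp)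
  exact congrArg (fun p : TangentBundle 𝓘(ℝ, F) F => (p.2 : F)) h4.symm

theorem contMDiffOn_chart_proj (he : e ∈ atlas F N) :
    ContMDiffOn 𝓘(ℝ, F).tangent 𝓘(ℝ, F) ∞ (fun p : TangentBundle 𝓘(ℝ, F) N => e p.1)
      {p | p.1 ∈ e.source} := by
  have h1 : ContMDiffOn 𝓘(ℝ, F) 𝓘(ℝ, F) ∞ e e.source := contMDiffOn_of_mem_maximalAtlas
    (IsManifold.subset_maximalAtlas he)
  exact h1.comp (Bundle.contMDiff_proj _).contMDiffOn fun p hp => hp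

theorem isOpen_proj_preimage_source (e : OpenPartialHomeomorph N F) :
    IsOpen {p : TangentBundle 𝓘(ℝ, F) N | p.1 ∈ e.source} :=
  e.open_source.preimage (FiberBundle.continuous_proj F (TangentSpace 𝓘(ℝ, F)))

end Velocity

/-! ### The quotient map in slice charts, and slice charts of the gauge group -/

section Submersion

variable {E : Type*} [NormedAddCommGroup E] [NormedSpace ℝ E]
  {F : Type*} [NormedAddCommGroup F] [NormedSpace ℝ F] {S : Set E} {r : Setoid S}

theorem isCurveThrough_const {x : E} (hx : x ∈ S) :
    IsCurveThrough S (fun _ => ⟨x, hx⟩) x 0 :=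
  ⟨rfl, hasDerivAt_const _ _, 1, one_pos, contDiffOn_const⟩

theorem zero_mem_tangentVectors {x : E} (hx : x ∈ S) : (0 : E) ∈ tangentVectors S x :=
  ⟨_, isCurveThrough_const hx⟩

namespace SliceChart

variable (c : SliceChart r F)

/-- The differential of a slice chart maps the tangent vectors of `S` onto `F`. -/
theorem exists_tangentVector {x : S} (hx : x.1 ∈ c.dom) (w : F) :
    ∃ v ∈ tangentVectors S x.1, fderiv ℝ c.toFun x.1 v = w := by
  classical
  obtain ⟨W, σ, hW, hxW, hσc, hσx, hσ⟩ := c.exists_section x hx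
  let l : ℝ → F := fun s => c.toFun x + s • w
  have hl : ContDiff ℝ ∞ l := contDiff_const.add (contDiff_id.smul contDiff_const)
  have hl0 : l 0 = c.toFun x := by simp [l]
  have hl' : HasDerivAt l w 0 := by
    simpa [l] using ((hasDerivAt_id (0 : ℝ)).smul_const w).const_add (c.toFun x)
  have hWl : l ⁻¹' W ∈ 𝓝 (0 : ℝ) :=
    hl.continuous.continuousAt.preimage_mem_nhds (by rw [hl0]; exact hW.mem_nhds hxW)
  obtain ⟨ε, hε, hεW⟩ := Metric.mem_nhds_iff.1 hWl
  rw [Real.ball_eq_Ioo, zero_sub, zero_add] at hεW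
  have hσd : HasFDerivAt σ (fderiv ℝ σ (l 0)) (l 0) := by
    rw [hl0]
    exact ((hσc.contDiffAt (hW.mem_nhds hxW)).differentiableAt (by simp)).hasFDerivAt
  have hcd : HasFDerivAt c.toFun (fderiv ℝ c.toFun x.1) x.1 :=
    ((c.contDiffOn_toFun.contDiffAt (c.isOpen_dom.mem_nhds hx)).differentiableAt
      (by simp)).hasFDerivAt
  have hd : HasDerivAt (σ ∘ l) (fderiv ℝ σ (l 0) w) 0 := hσd.comp_hasDerivAt 0 hl'
  let γ : ℝ → S := fun s => if hs : l s ∈ W then ⟨σ (l s), (hσ _ hs).1⟩ else x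
  have hγ : ∀ s, l s ∈ W → (γ s).1 = σ (l s) := fun s hs => by simp only [γ, dif_pos hs]
  refine ⟨fderiv ℝ σ (l 0) w, ⟨γ, ?_, ?_, ε, hε, ?_⟩, ?_⟩
  · rw [hγ 0 (by rwa [hl0]), hl0, hσx]
  · refine hd.congr_of_eventuallyEq ?_
    filter_upwards [hWl] with s hs using hγ s hs
  · exact (hσc.comp hl.contDiffOn hεW).congr fun s hs => hγ s (hεW hs)
  · have h1 : HasDerivAt (c.toFun ∘ (σ ∘ l)) (fderiv ℝ c.toFun x.1 (fderiv ℝ σ (l 0) w)) 0 := by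
      refine HasFDerivAt.comp_hasDerivAt 0 ?_ hd
      rw [Function.comp_apply, hl0, hσx]
      exact hcd
    refine h1.unique (hl'.congr_of_eventuallyEq ?_)
    filter_upwards [hWl] with s hs using (hσ _ hs).2.2

/-- If the differential of a slice chart maps `H y` bijectively onto `F` and `H` has a smooth local
frame, then the inverse bijections depend smoothly on the point along a section `σ`. -/
theorem exists_smooth_lift [CompleteSpace F] {H : E → Submodule ℝ E} {W : Set F} {σ : F → E}
    (hσc : ContDiffOn ℝ ∞ σ W) (hW : IsOpen W) (hσ : ∀ z ∈ W, σ z ∈ S ∧ σ z ∈ c.dom)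
    (hinj : ∀ x ∈ S, x ∈ c.dom → ∀ h ∈ H x, fderiv ℝ c.toFun x h = 0 → h = 0)
    (hsurj : ∀ x ∈ S, x ∈ c.dom → ∀ w : F, ∃ h ∈ H x, fderiv ℝ c.toFun x h = w)
    {z₀ : F} (hz₀ : z₀ ∈ W) {U : Set E} (hU : IsOpen U) (hxU : σ z₀ ∈ U) {n : ℕ}
    {X : Fin n → E → E} (hX : ∀ i, ContDiffOn ℝ ∞ (X i) U)
    (hframe : ∀ y ∈ U ∩ S, LinearIndependent ℝ (fun i => X i y) ∧
      Submodule.span ℝ (Set.range fun i => X i y) = H y) :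
    ∃ V ⊆ W, IsOpen V ∧ z₀ ∈ V ∧ ∃ h : F × F → E, ContDiffOn ℝ ∞ h (V ×ˢ Set.univ) ∧
      ∀ z ∈ V, ∀ w, h (z, w) ∈ H (σ z) ∧ fderiv ℝ c.toFun (σ z) (h (z, w)) = w := by
  -- The differential restricted to `H y`, in the coordinates of the frame.
  let L : E → ((Fin n → ℝ) →L[ℝ] F) := fun y =>
    ∑ i, (ContinuousLinearMap.proj i : (Fin n → ℝ) →L[ℝ] ℝ).smulRight (fderiv ℝ c.toFun y (X i y))
  have hL : ∀ y a, L y a = fderiv ℝ c.toFun y (∑ i, a i • X i y) := fun y a => by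
    simp [L, map_sum, map_smul]
  have hLc : ContDiffOn ℝ ∞ L (U ∩ c.dom) := by
    refine ContDiffOn.sum fun i _ => ?_
    have h1 : ContDiffOn ℝ ∞ (fun y => fderiv ℝ c.toFun y (X i y)) (U ∩ c.dom) :=
      ((c.contDiffOn_toFun.fderiv_of_isOpen c.isOpen_dom (by simp)).mono
        Set.inter_subset_right).clm_apply ((hX i).mono Set.inter_subset_left)
    exact contDiffOn_const.smulRight h1
  have hmem : ∀ y ∈ U ∩ S, ∀ a : Fin n → ℝ, ∑ i, a i • X i y ∈ H y := fun y hy a => by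
    rw [← (hframe y hy).2]
    exact Submodule.sum_mem _ fun i _ => Submodule.smul_mem _ _ (Submodule.subset_span ⟨i, rfl⟩)
  have hequiv : ∀ y ∈ U ∩ S, y ∈ c.dom → ∃ e : (Fin n → ℝ) ≃L[ℝ] F,
      (e : (Fin n → ℝ) →L[ℝ] F) = L y := by
    intro y hy hyd
    have hi : LinearMap.ker (L y : (Fin n → ℝ) →ₗ[ℝ] F) = ⊥ := by
      refine LinearMap.ker_eq_bot'.2 fun a ha => ?_
      have h1 := hinj y hy.2 hyd _ (hmem y hy a) (by rw [← hL]; exact ha)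
      exact funext (Fintype.linearIndependent_iff.1 (hframe y hy).1 a h1)
    have hs : LinearMap.range (L y : (Fin n → ℝ) →ₗ[ℝ] F) = ⊤ := by
      refine LinearMap.range_eq_top.2 fun w => ?_
      obtain ⟨h, hh, hw⟩ := hsurj y hy.2 hyd w
      rw [← (hframe y hy).2] at hh
      obtain ⟨a, rfl⟩ := (Submodule.mem_span_range_iff_exists_fun ℝ).1 hh
      exact ⟨a, (hL y a).trans hw⟩
    exact ⟨ContinuousLinearEquiv.ofBijective (L y) hi hs, rfl⟩
  have hVo : IsOpen (W ∩ σ ⁻¹' U) := hσc.continuousOn.isOpen_inter_preimage hW hU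
  have hmaps : ∀ z ∈ W ∩ σ ⁻¹' U, σ z ∈ U ∩ S ∧ σ z ∈ c.dom := fun z hz =>
    ⟨⟨hz.2, (hσ z hz.1).1⟩, (hσ z hz.1).2⟩
  refine ⟨W ∩ σ ⁻¹' U, Set.inter_subset_left, hVo, ⟨hz₀, hxU⟩,
    fun q => ∑ i, ((L (σ q.1)).inverse q.2) i • X i (σ q.1), ?_, ?_⟩
  · have hσ1 : ContDiffOn ℝ ∞ (fun q : F × F => σ q.1) ((W ∩ σ ⁻¹' U) ×ˢ Set.univ) :=
      hσc.comp contDiff_fst.contDiffOn fun q hq => hq.1.1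
    have hinv : ContDiffOn ℝ ∞ (fun q : F × F => (L (σ q.1)).inverse)
        ((W ∩ σ ⁻¹' U) ×ˢ Set.univ) := by
      have h1 : ContDiffOn ℝ ∞ (fun q : F × F => L (σ q.1)) ((W ∩ σ ⁻¹' U) ×ˢ Set.univ) :=
        hLc.comp hσ1 fun q hq => ⟨(hmaps q.1 hq.1).1.1, (hmaps q.1 hq.1).2⟩
      intro q hq
      obtain ⟨e, he⟩ := hequiv _ (hmaps q.1 hq.1).1 (hmaps q.1 hq.1).2
      have h2 : ContDiffAt ℝ ∞ ContinuousLinearMap.inverse (L (σ q.1)) := by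
        rw [← he]
        exact contDiffAt_map_inverse e
      exact h2.comp_contDiffWithinAt q (h1 q hq)
    refine ContDiffOn.sum fun i _ => ContDiffOn.smul ?_ ?_
    · exact contDiffOn_pi.1 (hinv.clm_apply contDiff_snd.contDiffOn) i
    · exact (hX i).comp hσ1 fun q hq => hq.1.2
  · intro z hz w
    refine ⟨hmem _ (hmaps z hz).1 _, ?_⟩
    obtain ⟨e, he⟩ := hequiv _ (hmaps z hz).1 (hmaps z hz).2
    rw [← hL, ← he, ContinuousLinearMap.inverse_equiv]
    exact e.apply_symm_apply w

variable [TopologicalSpace S] [HasSubspaceTopology S]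
  [ChartedSpace F (Quotient r)] [IsManifold 𝓘(ℝ, F) ∞ (Quotient r)]

/-- The differential of the quotient map, in the coordinates of a slice chart, is the differential
of the slice chart. -/
theorem pushesTo_iff (hc : c.chart ∈ atlas F (Quotient r)) {x : S} (hx : x.1 ∈ c.dom) (v : E)
    (p : TangentBundle 𝓘(ℝ, F) (Quotient r)) :
    PushesTo 𝓘(ℝ, F) (Quotient.mk r) x.1 v p ↔ v ∈ tangentVectors S x.1 ∧
      p.1 = Quotient.mk r x ∧ tcoord c.chart p = fderiv ℝ c.toFun x.1 v := by
  have key : ∀ γ : ℝ → S, IsCurveThrough S γ x.1 v →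
      (HasVelocity 𝓘(ℝ, F) (fun s => Quotient.mk r (γ s)) p ↔
        p.1 = Quotient.mk r x ∧ tcoord c.chart p = fderiv ℝ c.toFun x.1 v) := by
    intro γ hγ
    have h0 : γ 0 = x := Subtype.ext hγ.start
    have hcd : HasFDerivAt c.toFun (fderiv ℝ c.toFun x.1) (γ 0).1 := by
      rw [h0]
      exact ((c.contDiffOn_toFun.contDiffAt (c.isOpen_dom.mem_nhds hx)).differentiableAt
        (by simp)).hasFDerivAt
    rw [hasVelocity_iff hc (f := fun s => c.toFun (γ s).1) ?_
      (hcd.comp_hasDerivAt 0 hγ.velocity), h0]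
    have : ∀ᶠ s in 𝓝 (0 : ℝ), (γ s).1 ∈ c.dom :=
      hγ.velocity.continuousAt.eventually (by
        simp only [h0]
        exact c.isOpen_dom.mem_nhds hx)
    filter_upwards [this] with s hs using ⟨c.mk_mem_source.2 hs, c.chart_mk hs⟩
  constructor
  · rintro ⟨γ, hγ, h⟩
    exact ⟨⟨γ, hγ⟩, (key γ hγ).1 h⟩
  · rintro ⟨⟨γ, hγ⟩, h⟩
    exact ⟨γ, hγ, (key γ hγ).2 h⟩

/-- The quotient map extends smoothly to a neighbourhood of each point. -/
theorem exists_smooth_extension (hc : c.chart ∈ atlas F (Quotient r)) {x : S} (hx : x.1 ∈ c.dom) :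
    ∃ U : Set E, IsOpen U ∧ x.1 ∈ U ∧ ∃ g : E → Quotient r,
      ContMDiffOn 𝓘(ℝ, E) 𝓘(ℝ, F) ∞ g U ∧ ∀ y : S, y.1 ∈ U → Quotient.mk r y = g y := by
  refine ⟨c.dom ∩ c.toFun ⁻¹' c.chart.target,
    c.contDiffOn_toFun.continuousOn.isOpen_inter_preimage c.isOpen_dom c.chart.open_target,
    ⟨hx, c.toFun_mem_target hx⟩, c.chart.symm ∘ c.toFun, ?_, fun y hy =>
      (c.chart_symm_toFun hy.1).symm⟩
  have h1 : ContMDiffOn 𝓘(ℝ, F) 𝓘(ℝ, F) ∞ c.chart.symm c.chart.target :=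
    contMDiffOn_symm_of_mem_maximalAtlas (IsManifold.subset_maximalAtlas hc)
  exact h1.comp (c.contDiffOn_toFun.mono Set.inter_subset_left).contMDiffOn fun y hy => hy.2

theorem isSmoothSubmersion_mk (h : ∀ x : S, ∃ c : SliceChart r F, x.1 ∈ c.dom ∧
    c.chart ∈ atlas F (Quotient r)) :
    IsSmoothSubmersion 𝓘(ℝ, F) (Quotient.mk r : S → Quotient r) := by
  constructor
  · intro x
    obtain ⟨c, hx, hc⟩ := h x
    exact c.exists_smooth_extension hc hx
  · intro x w
    obtain ⟨c, hx, hc⟩ := h x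
    obtain ⟨v, hv, hvw⟩ := c.exists_tangentVector hx (tcoord c.chart ⟨Quotient.mk r x, w⟩)
    exact ⟨v, (c.pushesTo_iff hc hx v _).2 ⟨hv, rfl, hvw.symm⟩⟩

end SliceChart

end Submersion

section TTNSlice

variable {d : ℕ} {T : DimensionTree d} {k : Finset (Fin d) → ℕ}

theorem isOpen_normFamily_isUnit (x₀ : Param T k) :
    IsOpen {x : Param T k | ∀ t, IsUnit (normFamily x₀ x t).det} := by
  simp only [isUnit_iff_ne_zero, Set.ofPred_forall]
  refine isOpen_iInter_of_finite fun t => ?_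
  have h : ContDiff ℝ ∞ fun x : Param T k => (normFamily x₀ x t).det :=
    contDiff_iff_contDiffAt.2 fun x =>
      (contDiffWithinAt_normFamily x₀ contDiffWithinAt_id t).matrix_det
  exact isOpen_ne_fun h.continuous continuous_const

theorem isUnit_det_normFamily_gaugeAct {x₀ x : Param T k} (A : GaugeGroup T k)
    (h : ∀ t, IsUnit (normFamily x₀ x t).det) (t : Finset (Fin d)) :
    IsUnit (normFamily x₀ (gaugeAct x A) t).det := by
  rw [gaugeAct_eq_glAct, normFamily_glAct x₀ x (isUnit_det_gaugeAt_transpose A)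
    (fun t ht => by rw [gaugeAt_out A ht, Matrix.transpose_one]), Matrix.det_mul,
    Matrix.det_nonsing_inv]
  exact (h t).mul (isUnit_det_gaugeAt_transpose A t).ringInverse

theorem normalForm_gaugeAct (x₀ x : Param T k) (A : GaugeGroup T k) :
    normalForm x₀ (gaugeAct x A) = normalForm x₀ x := by
  rw [gaugeAct_eq_glAct]
  exact normalForm_glAct x₀ x (isUnit_det_gaugeAt_transpose A)
    (fun t ht => by rw [gaugeAt_out A ht, Matrix.transpose_one])

theorem contDiff_gaugeAct (A : GaugeGroup T k) :
    ContDiff ℝ ∞ fun x : Param T k => gaugeAct x A := by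
  simp only [gaugeAct_eq_glAct]
  exact contDiff_iff_contDiffAt.2 fun x => contDiffWithinAt_glAct (s := Set.univ)
    (fun t => contDiffWithinAt_const) contDiffWithinAt_id (isUnit_det_gaugeAt_transpose A)

theorem injective_of_transpose_mul_eq_one {a b : Type*} [Fintype a] [Fintype b] [DecidableEq b]
    {X Y : Matrix a b ℝ} (h : X.transpose * Y = 1) : Function.Injective Y.mulVec := by
  intro v w hvw
  have := congrArg X.transpose.mulVec hvw
  simpa only [Matrix.mulVec_mulVec, h, Matrix.one_mulVec] using this

theorem isUnit_det_inv {a : Type*} [Fintype a] [DecidableEq a] {G : Matrix a a ℝ}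
    (h : IsUnit G.det) : IsUnit (G⁻¹).det := by
  rw [Matrix.det_nonsing_inv]
  exact h.ringInverse

/-- Around each point of `𝒯`, the normal form with respect to this point is a slice chart for the
gauge group. Its sections orthonormalize the normal forms. -/
theorem exists_sliceChart (x₀ : orthTTN T k) :
    ∃ c : SliceChart (orbitSetoid T k) (EuclideanSpace ℝ (Fin (quotDim T k))),
      x₀.1 ∈ c.dom := by
  obtain ⟨ι, ρ, hρι, hι, hιρ⟩ := exists_sliceCoordinates x₀.2
  have hnf : ∀ x : Param T k, (∀ t, IsUnit (normFamily x₀.1 x t).det) →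
      x₀.1 + ι (ρ (normalForm x₀.1 x - x₀.1)) = normalForm x₀.1 x := by
    intro x hx
    rw [hιρ, add_sub_cancel]
    intro t
    rw [Pi.sub_apply, Matrix.mul_sub, transpose_mul_normalForm hx t]
    exact sub_eq_zero.2 (x₀.2.2 t).symm
  have hC : ∀ z (t : T.NonRoot), (x₀.1 t.1).transpose * (x₀.1 + ι z) t.1 = 1 := by
    intro z t
    rw [Pi.add_apply, Matrix.mul_add, hι, add_zero]
    exact x₀.2.2 t
  have hCi : ∀ z (t : T.NonRoot), Function.Injective ((x₀.1 + ι z) t.1).mulVec := fun z t =>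
    injective_of_transpose_mul_eq_one (hC z t)
  have hnorm : ∀ z t, normFamily x₀.1 (glAct (orthFamily (x₀.1 + ι z)) (x₀.1 + ι z)) t =
      (orthFamily (x₀.1 + ι z) t)⁻¹ := by
    intro z t
    rw [normFamily_glAct _ _ (isUnit_det_orthFamily (hCi z)) (fun t ht => orthFamily_out _ ht),
      normFamily_eq_one (hC z), Matrix.one_mul]
  refine ⟨{
    center := x₀
    dom := {x | ∀ t, IsUnit (normFamily x₀.1 x t).det}
    toFun := fun x => ρ (normalForm x₀.1 x - x₀.1)
    isOpen_dom := isOpen_normFamily_isUnit x₀.1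
    contDiffOn_toFun := ?_
    saturated := ?_
    separates := ?_
    exists_section := ?_ }, ?_⟩
  · intro x hx
    exact ρ.contDiff.contDiffAt.comp_contDiffWithinAt x ((contDiffWithinAt_glAct
      (contDiffWithinAt_normFamily x₀.1 contDiffWithinAt_id) contDiffWithinAt_id hx).sub
        contDiffWithinAt_const)
  · rintro x y ⟨A, hA⟩ hx
    rw [hA]
    exact ⟨isUnit_det_normFamily_gaugeAct A hx, by simp only [normalForm_gaugeAct]⟩
  · intro x y hx hy h
    have h1 : normalForm x₀.1 x.1 = normalForm x₀.1 y.1 := by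
      rw [← hnf x hx, ← hnf y hy]
      exact congrArg (fun z => x₀.1 + ι z) h
    have h2 : y.1 = glAct (fun t => (normFamily x₀.1 y.1 t)⁻¹ * normFamily x₀.1 x.1 t) x.1 := by
      rw [← glAct_glAct (fun t => (normFamily x₀.1 y.1 t)⁻¹) (normFamily x₀.1 x.1)]
      change _ = glAct _ (normalForm x₀.1 x.1)
      rw [h1]
      exact (glAct_inv_glAct hy y.1).symm
    refine exists_gauge x.2 y.2 (fun t => ?_) (fun t ht => ?_) h2
    · rw [Matrix.det_mul]
      exact (isUnit_det_inv (hy t)).mul (hx t)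
    · rw [normFamily_out _ _ ht, normFamily_out _ _ ht, inv_one, Matrix.one_mul]
  · intro x hx
    set z₀ := ρ (normalForm x₀.1 x.1 - x₀.1) with hz₀
    have hz₀' : x₀.1 + ι z₀ = normalForm x₀.1 x.1 := hnf x hx
    have hfr : IsFullRank T k (x₀.1 + ι z₀) := by
      rw [hz₀']
      exact (isFullRank_glAct hx).2 x.2.1
    -- The section through `x` itself, and not only through an equivalent point, is obtained by a
    -- fixed gauge `A`.
    obtain ⟨A, hA⟩ : ∃ A : GaugeGroup T k,
        x.1 = gaugeAct (glAct (orthFamily (x₀.1 + ι z₀)) (x₀.1 + ι z₀)) A := by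
      have hN := isUnit_det_orthFamily (hCi z₀)
      refine exists_gauge (glAct_orthFamily_mem (hCi z₀) hfr) x.2
        (G := fun t => (normFamily x₀.1 x.1 t)⁻¹ * (orthFamily (x₀.1 + ι z₀) t)⁻¹)
        (fun t => ?_) (fun t ht => ?_) ?_
      · rw [Matrix.det_mul]
        exact (isUnit_det_inv (hx t)).mul (isUnit_det_inv (hN t))
      · rw [normFamily_out _ _ ht, orthFamily_out _ ht, inv_one, Matrix.one_mul]
      · rw [← glAct_glAct (fun t => (normFamily x₀.1 x.1 t)⁻¹)
          (fun t => (orthFamily (x₀.1 + ι z₀) t)⁻¹), glAct_inv_glAct hN, hz₀']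
        exact (glAct_inv_glAct hx x.1).symm
    have hcont : Continuous fun z => x₀.1 + ι z := continuous_const.add ι.continuous
    refine ⟨{z | IsFullRank T k (x₀.1 + ι z)},
      fun z => gaugeAct (glAct (orthFamily (x₀.1 + ι z)) (x₀.1 + ι z)) A,
      isOpen_isFullRank.preimage hcont, hfr, ?_, hA.symm, ?_⟩
    · intro z _
      have h1 : ContDiffAt ℝ ∞ (fun z => x₀.1 + ι z) z :=
        contDiffAt_const.add ι.contDiff.contDiffAt
      have h2 : ContDiffAt ℝ ∞ (fun z => glAct (orthFamily (x₀.1 + ι z)) (x₀.1 + ι z)) z :=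
        contDiffWithinAt_glAct (fun t => contDiffWithinAt_orthFamily h1 (hCi z) t) h1
          (isUnit_det_orthFamily (hCi z))
      exact ((contDiff_gaugeAct A).contDiffAt.comp z h2).contDiffWithinAt
    · intro z hz
      have hN := isUnit_det_orthFamily (hCi z)
      refine ⟨gaugeAct_mem (glAct_orthFamily_mem (hCi z) hz) A, ?_, ?_⟩
      · refine isUnit_det_normFamily_gaugeAct A fun t => ?_
        rw [hnorm]
        exact isUnit_det_inv (hN t)
      · rw [normalForm_gaugeAct, normalForm_glAct _ _ hN (fun t ht => orthFamily_out _ ht),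
          normalForm_eq_self (hC z), add_sub_cancel_left, hρι]
  · intro t
    rw [normFamily_eq_one (fun t => x₀.2.2 t), Matrix.det_one]
    exact isUnit_one

end TTNSlice

/-! ### The Cartesian retraction and the equivariance of the polar and Cayley maps -/

section Embedded

variable {E : Type*} [NormedAddCommGroup E] [NormedSpace ℝ E]
  {F : Type*} [NormedAddCommGroup F] [NormedSpace ℝ F] {S : Set E} {S' : Set F}

theorem IsCurveThrough.map {c : ℝ → S} {x v : E} (h : IsCurveThrough S c x v) (L : E →L[ℝ] F)
    (hL : ∀ y ∈ S, L y ∈ S') :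
    IsCurveThrough S' (fun s => ⟨L (c s), hL _ (c s).2⟩) (L x) (L v) := by
  obtain ⟨ε, hε, hc⟩ := h.smooth
  exact ⟨congrArg L h.start, L.hasFDerivAt.comp_hasDerivAt 0 h.velocity, ε, hε,
    L.contDiff.comp_contDiffOn hc⟩

theorem map_mem_tangentPairs {p : E × E} (h : p ∈ tangentPairs S) (L : E →L[ℝ] F)
    (hL : ∀ y ∈ S, L y ∈ S') : (L p.1, L p.2) ∈ tangentPairs S' :=
  ⟨hL _ h.1, h.2.imp' _ fun _ hc => hc.map L hL⟩

theorem IsSmoothOn.mono {A B : Set E} {f : E → F} (h : IsSmoothOn B f) (hAB : A ⊆ B) :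
    IsSmoothOn A f := fun x hx => by
  obtain ⟨U, hU, hxU, g, hg, hfg⟩ := h x (hAB hx)
  exact ⟨U, hU, hxU, g, hg, hfg.mono (Set.inter_subset_inter_right _ hAB)⟩

/-- Open conditions on the values of a smooth map define relatively open subsets. -/
theorem IsSmoothOn.exists_isOpen_inter {A B U : Set E} {f : E → F} {O : Set F}
    (hU : IsOpen U) (hA : A = B ∩ U) (hf : IsSmoothOn A f) (hO : IsOpen O) :
    ∃ V : Set E, IsOpen V ∧ {p | p ∈ A ∧ f p ∈ O} = B ∩ V := by
  refine ⟨⋃₀ {V | IsOpen V ∧ B ∩ V ⊆ {p | p ∈ A ∧ f p ∈ O}},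
    isOpen_sUnion fun V hV => hV.1, Set.Subset.antisymm ?_ ?_⟩
  · rintro p ⟨hpA, hpO⟩
    obtain ⟨V, hV, hpV, g, hg, hfg⟩ := hf p hpA
    have hp : p ∈ B ∩ U := hA ▸ hpA
    refine ⟨hp.1, _, ⟨(hg.continuousOn.isOpen_inter_preimage hV hO).inter hU, ?_⟩,
      ⟨⟨hpV, ?_⟩, hp.2⟩⟩
    · rintro q ⟨hqB, ⟨hqV, hqO⟩, hqU⟩
      have hqA : q ∈ A := hA ▸ ⟨hqB, hqU⟩
      refine ⟨hqA, ?_⟩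
      rw [hfg ⟨hqV, hqA⟩]
      exact hqO
    · rw [Set.mem_preimage, ← hfg ⟨hpV, hpA⟩]
      exact hpO
  · rintro p ⟨hpB, V, ⟨-, hV⟩, hpV⟩
    exact hV ⟨hpB, hpV⟩

end Embedded

section Cartesian

variable {d : ℕ} {T : DimensionTree d} {k : Finset (Fin d) → ℕ} {D : NodeDomains T k}
  {R : NodeMaps T k}

theorem cartesianRetraction_nonRoot (x ξ : Param T k) (t : T.NonRoot) :
    cartesianRetraction R x ξ t.1 = R t (x t.1) (ξ t.1) := dif_pos t.2

theorem cartesianRetraction_root (x ξ : Param T k) {t : T.Internal} (h : ¬ t.1 ≠ Finset.univ) :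
    cartesianRetraction R x ξ t = x t + ξ t := dif_neg h

theorem component_mem_tangentPairs {p : Param T k × Param T k}
    (h : p ∈ tangentPairs (orthTTN T k)) (t : T.NonRoot) :
    (p.1 t.1, p.2 t.1) ∈ tangentPairs (stiefel
      (Fin (k (T.left t.1.1)) × Fin (k (T.right t.1.1))) (Fin (k t.1.1))) :=
  map_mem_tangentPairs h (ContinuousLinearMap.proj (R := ℝ) (φ := NodeSpace T k) t.1)
    fun _ hy => hy.2 t

theorem isSmoothOn_cartesianRetraction (hR : AreStiefelRetractions D R) :
    IsSmoothOn {p : Param T k × Param T k | ∀ t : T.NonRoot, (p.1 t.1, p.2 t.1) ∈ D t}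
      (fun p => cartesianRetraction R p.1 p.2) := by
  intro p hp
  choose U hU hpU g hg hRg using fun t => (hR t).smooth (p.1 t.1, p.2 t.1) (hp t)
  have hproj : ∀ t : T.Internal,
      ContDiff ℝ ∞ fun q : Param T k × Param T k => (q.1 t, q.2 t) := fun t =>
    let L := ContinuousLinearMap.proj (R := ℝ) (φ := NodeSpace T k) t
    (L.contDiff.comp contDiff_fst).prodMk (L.contDiff.comp contDiff_snd)
  refine ⟨⋂ t : T.NonRoot, (fun q : Param T k × Param T k => (q.1 t.1, q.2 t.1)) ⁻¹' U t,
    isOpen_iInter_of_finite fun t => (hU t).preimage (hproj t.1).continuous,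
    Set.mem_iInter.2 hpU,
    fun q t => if h : t.1 ≠ Finset.univ then g ⟨t, h⟩ (q.1 t, q.2 t) else q.1 t + q.2 t, ?_, ?_⟩
  · refine contDiffOn_pi.2 fun t => ?_
    by_cases h : t.1 ≠ Finset.univ
    · simp only [dif_pos h]
      exact (hg ⟨t, h⟩).comp (hproj t).contDiffOn fun q hq => Set.mem_iInter.1 hq ⟨t, h⟩
    · simp only [dif_neg h]
      exact (contDiff_fst.add contDiff_snd).comp_contDiffOn (hproj t).contDiffOn
  · rintro q ⟨hqU, hqD⟩
    funext t
    by_cases h : t.1 ≠ Finset.univ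
    · simp only [dif_pos h]
      exact (cartesianRetraction_nonRoot q.1 q.2 ⟨t, h⟩).trans
        (hRg ⟨t, h⟩ ⟨Set.mem_iInter.1 hqU ⟨t, h⟩, hqD ⟨t, h⟩⟩)
    · simp only [dif_neg h]
      exact cartesianRetraction_root q.1 q.2 h

theorem cartesianRetraction_zero (hR : AreStiefelRetractions D R) {x : Param T k}
    (hx : x ∈ orthTTN T k) : cartesianRetraction R x 0 = x := by
  funext t
  by_cases h : t.1 ≠ Finset.univ
  · exact (cartesianRetraction_nonRoot x 0 ⟨t, h⟩).trans ((hR ⟨t, h⟩).map_zero _ (hx.2 ⟨t, h⟩))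
  · rw [cartesianRetraction_root x 0 h]
    exact add_zero _

theorem cartesianRetraction_mem (hR : AreStiefelRetractions D R) {p : Param T k × Param T k}
    (hp : p ∈ cartesianDomain D R) : cartesianRetraction R p.1 p.2 ∈ orthTTN T k := by
  refine ⟨hp.2.2, fun t => ?_⟩
  rw [cartesianRetraction_nonRoot]
  exact (hR t).mapsTo _ (hp.2.1 t)

/-- The Cartesian product of retractions on the Stiefel manifolds is a retraction on `𝒯`. -/
theorem isRetraction_cartesianRetraction (hR : AreStiefelRetractions D R) :
    IsRetraction (orthTTN T k) (cartesianDomain D R) (cartesianRetraction R) := by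
  refine ⟨?_, ?_, fun p hp => cartesianRetraction_mem hR hp, ?_,
    fun x hx => cartesianRetraction_zero hR hx, ?_⟩
  · choose U hU hDU using fun t => (hR t).isOpen_domain
    have hU' : IsOpen (⋂ t : T.NonRoot,
        (fun q : Param T k × Param T k => (q.1 t.1, q.2 t.1)) ⁻¹' U t) :=
      isOpen_iInter_of_finite fun t => (hU t).preimage
        (((continuous_apply t.1).comp continuous_fst).prodMk
          ((continuous_apply t.1).comp continuous_snd))
    have hsub : tangentPairs (orthTTN T k) ∩ ⋂ t : T.NonRoot,
        (fun q : Param T k × Param T k => (q.1 t.1, q.2 t.1)) ⁻¹' U t ⊆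
        {p : Param T k × Param T k | ∀ t : T.NonRoot, (p.1 t.1, p.2 t.1) ∈ D t} := by
      rintro p ⟨hp, hpU⟩ t
      rw [hDU t]
      exact ⟨component_mem_tangentPairs hp t, Set.mem_iInter.1 hpU t⟩
    obtain ⟨V, hV, hVeq⟩ := IsSmoothOn.exists_isOpen_inter hU' rfl
      ((isSmoothOn_cartesianRetraction hR).mono hsub) isOpen_isFullRank
    refine ⟨V, hV, ?_⟩
    rw [← hVeq]
    ext p
    constructor
    · rintro ⟨h1, h2, h3⟩
      exact ⟨⟨h1, Set.mem_iInter.2 fun t => (hDU t ▸ h2 t).2⟩, h3⟩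
    · rintro ⟨h1, h3⟩
      exact ⟨h1.1, hsub h1, h3⟩
  · intro x hx
    refine ⟨⟨hx, zero_mem_tangentVectors hx⟩, fun t => (hR t).zero_mem _ (hx.2 t), ?_⟩
    change IsFullRank T k (cartesianRetraction R x 0)
    rw [cartesianRetraction_zero hR hx]
    exact hx.1
  · exact (isSmoothOn_cartesianRetraction hR).mono fun p hp => hp.2.1
  · intro p hp
    refine hasDerivAt_pi.2 fun t => ?_
    by_cases h : t.1 ≠ Finset.univ
    · exact ((hR ⟨t, h⟩).velocity _ (component_mem_tangentPairs hp ⟨t, h⟩)).congr_of_eventuallyEq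
        (Filter.Eventually.of_forall fun s => cartesianRetraction_nonRoot p.1 (s • p.2) ⟨t, h⟩)
    · refine HasDerivAt.congr_of_eventuallyEq ?_
        (Filter.Eventually.of_forall fun s => cartesianRetraction_root p.1 (s • p.2) h)
      simpa using ((hasDerivAt_id (0 : ℝ)).smul_const (p.2 t)).const_add (p.1 t)

end Cartesian

section Equivariance

variable {n m : Type*} [Fintype n] [DecidableEq n] [Fintype m] [DecidableEq m]

theorem orthogonal_mul_transpose {Q : Matrix n n ℝ} (hQ : Q ∈ Matrix.orthogonalGroup n ℝ) :
    Q * Q.transpose = 1 := (Matrix.mem_orthogonalGroup_iff _ _).1 hQ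

theorem orthogonal_transpose_mul {Q : Matrix n n ℝ} (hQ : Q ∈ Matrix.orthogonalGroup n ℝ) :
    Q.transpose * Q = 1 := (Matrix.mem_orthogonalGroup_iff' _ _).1 hQ

theorem mul_mul_mem_tangentPairs {Q : Matrix n n ℝ} (hQ : Q ∈ Matrix.orthogonalGroup n ℝ)
    {W : Matrix m m ℝ} (hW : W ∈ Matrix.orthogonalGroup m ℝ) {X V : Matrix n m ℝ}
    (h : (X, V) ∈ tangentPairs (stiefel n m)) :
    (Q * X * W, Q * V * W) ∈ tangentPairs (stiefel n m) :=
  map_mem_tangentPairs h (LinearMap.toContinuousLinearMap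
    ((mulRightLinearMap n ℝ W).comp (mulLeftLinearMap m ℝ Q)))
    fun _ hy => mul_mul_mem_stiefel (orthogonal_transpose_mul hQ) hy (orthogonal_transpose_mul hW)

theorem inv_conj {Q A : Matrix n n ℝ} (hQ : Q * Q.transpose = 1) :
    (Q * A * Q.transpose)⁻¹ = Q * A⁻¹ * Q.transpose := by
  rw [Matrix.mul_inv_rev, Matrix.mul_inv_rev, Matrix.inv_eq_right_inv hQ,
    Matrix.inv_eq_right_inv (mul_eq_one_comm.1 hQ), Matrix.mul_assoc]

theorem polarMap_equivariant {Q : Matrix n n ℝ} (hQ : Q ∈ Matrix.orthogonalGroup n ℝ)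
    {W : Matrix m m ℝ} (hW : W ∈ Matrix.orthogonalGroup m ℝ) (X V : Matrix n m ℝ) :
    polarMap (Q * X * W) (Q * V * W) = Q * polarMap X V * W := by
  have hQ1 := orthogonal_transpose_mul hQ
  have hW1 := orthogonal_mul_transpose hW
  have hW2 := orthogonal_transpose_mul hW
  have h1 : 1 + (Q * V * W).transpose * (Q * V * W) =
      W.transpose * (1 + V.transpose * V) * W := by
    have : (Q * V * W).transpose * (Q * V * W) =
        W.transpose * (V.transpose * (Q.transpose * Q) * V) * W := by
      simp only [Matrix.transpose_mul, Matrix.mul_assoc]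
    rw [this, hQ1, Matrix.mul_one, Matrix.mul_add, Matrix.add_mul, Matrix.mul_one, hW2]
  have hps : (1 + V.transpose * V).PosSemidef := by
    have := Matrix.posSemidef_conjTranspose_mul_self V
    rw [Matrix.conjTranspose_eq_transpose_of_trivial] at this
    exact Matrix.PosSemidef.one.add this
  have h2 := inv_conj (Q := W.transpose) (A := psqrt (1 + V.transpose * V))
    (by rwa [Matrix.transpose_transpose])
  rw [Matrix.transpose_transpose] at h2
  change (Q * X * W + Q * V * W) * (psqrt (1 + (Q * V * W).transpose * (Q * V * W)))⁻¹ =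
    Q * ((X + V) * (psqrt (1 + V.transpose * V))⁻¹) * W
  rw [h1, psqrt_conj hps hW1, h2, ← Matrix.add_mul, ← Matrix.mul_add]
  calc _ = Q * ((X + V) * (W * W.transpose) * (psqrt (1 + V.transpose * V))⁻¹) * W := by
        simp only [Matrix.mul_assoc]
    _ = _ := by rw [hW1, Matrix.mul_one]

theorem cayleyGenerator_equivariant {Q : Matrix n n ℝ} (hQ : Q ∈ Matrix.orthogonalGroup n ℝ)
    {W : Matrix m m ℝ} (hW : W ∈ Matrix.orthogonalGroup m ℝ) (X V : Matrix n m ℝ) :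
    cayleyGenerator (Q * X * W) (Q * V * W) = Q * cayleyGenerator X V * Q.transpose := by
  have hQ1 := orthogonal_transpose_mul hQ
  have hQ2 := orthogonal_mul_transpose hQ
  have hW1 := orthogonal_mul_transpose hW
  have h1 : ∀ A B : Matrix n m ℝ,
      Q * A * W * (Q * B * W).transpose = Q * (A * B.transpose) * Q.transpose := by
    intro A B
    calc _ = Q * A * (W * W.transpose) * B.transpose * Q.transpose := by
          simp only [Matrix.transpose_mul, Matrix.mul_assoc]
      _ = _ := by rw [hW1, Matrix.mul_one]; simp only [Matrix.mul_assoc]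
  have h2 : (1 : Matrix n n ℝ) - (1 / 2 : ℝ) • (Q * X * W * (Q * X * W).transpose) =
      Q * (1 - (1 / 2 : ℝ) • (X * X.transpose)) * Q.transpose := by
    rw [h1, Matrix.mul_sub, Matrix.sub_mul, Matrix.mul_one, hQ2, Matrix.mul_smul, Matrix.smul_mul]
  rw [cayleyGenerator, h2, cayleyGenerator]
  generalize (1 : Matrix n n ℝ) - (1 / 2 : ℝ) • (X * X.transpose) = P
  rw [Matrix.mul_assoc _ (Q * V * W), h1, h1, Matrix.mul_sub, Matrix.sub_mul]
  congr 1
  · calc _ = Q * P * (Q.transpose * Q) * (V * X.transpose) * Q.transpose := by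
          simp only [Matrix.mul_assoc]
      _ = _ := by rw [hQ1, Matrix.mul_one]; simp only [Matrix.mul_assoc]
  · calc _ = Q * (X * V.transpose) * (Q.transpose * Q) * P * Q.transpose := by
          simp only [Matrix.mul_assoc]
      _ = _ := by rw [hQ1, Matrix.mul_one]; simp only [Matrix.mul_assoc]

theorem cayleyMap_equivariant {Q : Matrix n n ℝ} (hQ : Q ∈ Matrix.orthogonalGroup n ℝ)
    {W : Matrix m m ℝ} (hW : W ∈ Matrix.orthogonalGroup m ℝ) (X V : Matrix n m ℝ) :
    cayleyMap (Q * X * W) (Q * V * W) = Q * cayleyMap X V * W := by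
  have hQ1 := orthogonal_transpose_mul hQ
  have hQ2 := orthogonal_mul_transpose hQ
  rw [cayleyMap, cayleyGenerator_equivariant hQ hW, cayleyMap]
  generalize cayleyGenerator X V = S
  have h1 : (1 : Matrix n n ℝ) - (1 / 2 : ℝ) • (Q * S * Q.transpose) =
      Q * (1 - (1 / 2 : ℝ) • S) * Q.transpose := by
    rw [Matrix.mul_sub, Matrix.sub_mul, Matrix.mul_one, hQ2, Matrix.mul_smul, Matrix.smul_mul]
  have h2 : (1 : Matrix n n ℝ) + (1 / 2 : ℝ) • (Q * S * Q.transpose) =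
      Q * (1 + (1 / 2 : ℝ) • S) * Q.transpose := by
    rw [Matrix.mul_add, Matrix.add_mul, Matrix.mul_one, hQ2, Matrix.mul_smul, Matrix.smul_mul]
  rw [h1, h2, inv_conj hQ2]
  generalize (1 - (1 / 2 : ℝ) • S)⁻¹ = A
  generalize 1 + (1 / 2 : ℝ) • S = B
  calc _ = Q * A * (Q.transpose * Q) * B * (Q.transpose * Q) * X * W := by
        simp only [Matrix.mul_assoc]
    _ = _ := by rw [hQ1, Matrix.mul_one, Matrix.mul_one]; simp only [Matrix.mul_assoc]

end Equivariance

/-! ### Horizontal lifts and the induced retraction -/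

section Gauge

variable {d : ℕ} {T : DimensionTree d} {k : Finset (Fin d) → ℕ}

/-- The action of a gauge as a continuous linear map. -/
noncomputable def gaugeActL (A : GaugeGroup T k) : Param T k →L[ℝ] Param T k :=
  LinearMap.toContinuousLinearMap
    { toFun := fun x => gaugeAct x A
      map_add' := fun x y => by
        funext t
        simp only [gaugeAct, Pi.add_apply, Matrix.mul_add, Matrix.add_mul]
      map_smul' := fun s x => by
        funext t
        simp only [gaugeAct, Pi.smul_apply, Matrix.mul_smul, Matrix.smul_mul, RingHom.id_apply] }

theorem quotMap_gaugeAct (x : orthTTN T k) (A : GaugeGroup T k) :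
    quotMap T k ⟨gaugeAct x.1 A, gaugeAct_mem x.2 A⟩ = quotMap T k x :=
  (Quotient.sound ⟨A, rfl⟩ : quotMap T k x = _).symm

theorem exists_gauge_of_quotMap_eq {x y : orthTTN T k} (h : quotMap T k x = quotMap T k y) :
    ∃ A : GaugeGroup T k, y.1 = gaugeAct x.1 A := Quotient.exact h

theorem gaugeAct_mem_tangentPairs {p : Param T k × Param T k}
    (h : p ∈ tangentPairs (orthTTN T k)) (A : GaugeGroup T k) :
    (gaugeAct p.1 A, gaugeAct p.2 A) ∈ tangentPairs (orthTTN T k) :=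
  map_mem_tangentPairs h (gaugeActL A) fun _ hy => gaugeAct_mem hy A

theorem gaugeFactor_mem (A : GaugeGroup T k) (s t : Finset (Fin d)) :
    (gaugeAt A s ⊗ₖ gaugeAt A t).transpose ∈
      Matrix.orthogonalGroup (Fin (k s) × Fin (k t)) ℝ :=
  (Matrix.mem_orthogonalGroup_iff' _ _).2 (gaugeFactor_transpose_mul_self A s t)

section Equivariant

variable {D : NodeDomains T k} {R : NodeMaps T k}
  (hE : ∀ t : T.NonRoot, IsOrthogonallyEquivariant (D t) (R t))

include hE in
/-- At each node, the gauge action multiplies from the left and from the right by orthogonal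
matrices. -/
theorem cartesianRetraction_gaugeAct {p : Param T k × Param T k}
    (hp : ∀ t : T.NonRoot, (p.1 t.1, p.2 t.1) ∈ D t) (A : GaugeGroup T k) :
    cartesianRetraction R (gaugeAct p.1 A) (gaugeAct p.2 A) =
      gaugeAct (cartesianRetraction R p.1 p.2) A := by
  funext t
  by_cases h : t.1 ≠ Finset.univ
  · refine (cartesianRetraction_nonRoot _ _ ⟨t, h⟩).trans ?_
    rw [gaugeAct, gaugeAct, gaugeAct, cartesianRetraction_nonRoot p.1 p.2 ⟨t, h⟩]
    exact (hE ⟨t, h⟩ _ (gaugeFactor_mem A _ _) _ (gaugeAt_mem A _) _ _ (hp ⟨t, h⟩)).2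
  · rw [cartesianRetraction_root _ _ h, gaugeAct, gaugeAct, gaugeAct,
      cartesianRetraction_root _ _ h, Matrix.mul_add, Matrix.add_mul]

include hE in
theorem gaugeAct_mem_cartesianDomain {p : Param T k × Param T k} (hp : p ∈ cartesianDomain D R)
    (A : GaugeGroup T k) : (gaugeAct p.1 A, gaugeAct p.2 A) ∈ cartesianDomain D R := by
  refine ⟨gaugeAct_mem_tangentPairs hp.1 A, fun t => ?_, ?_⟩
  · exact (hE t _ (gaugeFactor_mem A _ _) _ (gaugeAt_mem A _) _ _ (hp.2.1 t)).1
  · change IsFullRank T k (cartesianRetraction R (gaugeAct p.1 A) (gaugeAct p.2 A))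
    rw [cartesianRetraction_gaugeAct hE hp.2.1, gaugeAct_eq_glAct]
    exact (isFullRank_glAct (isUnit_det_gaugeAt_transpose A)).2 hp.2.2

end Equivariant

section Quotient

instance : HasSubspaceTopology (orthTTN T k) := ⟨Topology.IsInducing.subtypeVal⟩

variable {F : Type*} [NormedAddCommGroup F] [NormedSpace ℝ F]
  [ChartedSpace F (TTNQuotient T k)]

theorem pushesTo_gaugeAct {x : orthTTN T k} {v : Param T k}
    {p : TangentBundle 𝓘(ℝ, F) (TTNQuotient T k)}
    (h : PushesTo 𝓘(ℝ, F) (quotMap T k) x.1 v p) (A : GaugeGroup T k) :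
    PushesTo 𝓘(ℝ, F) (quotMap T k) (gaugeAct x.1 A) (gaugeAct v A) p := by
  obtain ⟨c, hc, hv⟩ := h
  refine ⟨_, hc.map (gaugeActL A) fun _ hy => gaugeAct_mem hy A, ?_⟩
  have : (fun s => quotMap T k (c s)) =
      fun s => quotMap T k ⟨gaugeActL A (c s).1, gaugeAct_mem (c s).2 A⟩ :=
    (funext fun s => quotMap_gaugeAct (c s) A).symm
  exact this ▸ hv

theorem isHorizontalLift_gaugeAct {H : Param T k → Submodule ℝ (Param T k)}
    (hH : IsHorizontal 𝓘(ℝ, F) H) {x : orthTTN T k} {h : Param T k}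
    {p : TangentBundle 𝓘(ℝ, F) (TTNQuotient T k)} (hl : IsHorizontalLift 𝓘(ℝ, F) H x p h)
    (A : GaugeGroup T k) :
    IsHorizontalLift 𝓘(ℝ, F) H ⟨gaugeAct x.1 A, gaugeAct_mem x.2 A⟩ p (gaugeAct h A) :=
  ⟨(hH.invariant _ x.2 A h).1 hl.1, pushesTo_gaugeAct hl.2 A⟩

theorem IsHorizontalLift.mem_tangentPairs {H : Param T k → Submodule ℝ (Param T k)}
    (hH : IsHorizontal 𝓘(ℝ, F) H) {x : orthTTN T k}
    {p : TangentBundle 𝓘(ℝ, F) (TTNQuotient T k)} {h : Param T k}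
    (hl : IsHorizontalLift 𝓘(ℝ, F) H x p h) : (x.1, h) ∈ tangentPairs (orthTTN T k) :=
  ⟨x.2, hH.subset _ x.2 hl.1⟩

variable [IsManifold 𝓘(ℝ, F) ∞ (TTNQuotient T k)]
  {H : Param T k → Submodule ℝ (Param T k)} (hH : IsHorizontal 𝓘(ℝ, F) H)
  {c : SliceChart (orbitSetoid T k) F} (hc : c.chart ∈ atlas F (TTNQuotient T k))

include hH hc

/-- The differential of a slice chart is injective on the horizontal space. -/
theorem IsHorizontal.eq_zero {x : Param T k} (hx : x ∈ orthTTN T k) (hxc : x ∈ c.dom)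
    {h : Param T k} (hh : h ∈ H x) (h0 : fderiv ℝ c.toFun x h = 0) : h = 0 := by
  have hvert : ∀ v ∈ tangentVectors (orthTTN T k) x, fderiv ℝ c.toFun x v = 0 →
      v ∈ verticalVectors 𝓘(ℝ, F) ⟨x, hx⟩ := fun v hv hv0 =>
    (c.pushesTo_iff hc (x := ⟨x, hx⟩) hxc v _).2 ⟨hv, rfl, (tcoord_zero _ _).trans hv0.symm⟩
  -- If `h` is horizontal and vertical, both `h` and `0` are its horizontal part.
  refine (hH.complement ⟨x, hx⟩ h (hH.subset x hx hh)).unique ⟨hh, ?_⟩ ⟨(H x).zero_mem, ?_⟩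
  · rw [sub_self]
    exact hvert 0 (zero_mem_tangentVectors hx) (map_zero _)
  · rw [sub_zero]
    exact hvert h (hH.subset x hx hh) h0

/-- The differential of a slice chart maps the horizontal space onto the model space. -/
theorem IsHorizontal.exists_eq {x : Param T k} (hx : x ∈ orthTTN T k) (hxc : x ∈ c.dom)
    (w : F) : ∃ h ∈ H x, fderiv ℝ c.toFun x h = w := by
  obtain ⟨v, hv, hvw⟩ := c.exists_tangentVector (x := ⟨x, hx⟩) hxc w
  obtain ⟨h, ⟨hh, hvh⟩, -⟩ := hH.complement ⟨x, hx⟩ v hv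
  refine ⟨h, hh, ?_⟩
  have h1 := ((c.pushesTo_iff hc (x := ⟨x, hx⟩) hxc _ _).1 hvh).2.2
  rw [tcoord_zero, map_sub, eq_comm, sub_eq_zero] at h1
  exact h1.symm.trans hvw

/-- In the coordinates of a slice chart, horizontal lifts are determined by a linear equation. -/
theorem IsHorizontal.isHorizontalLift_iff {x : orthTTN T k} (hxc : x.1 ∈ c.dom)
    {p : TangentBundle 𝓘(ℝ, F) (TTNQuotient T k)} (hp : p.1 = quotMap T k x) {h : Param T k} :
    IsHorizontalLift 𝓘(ℝ, F) H x p h ↔ h ∈ H x.1 ∧ fderiv ℝ c.toFun x.1 h = tcoord c.chart p := by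
  refine and_congr_right fun hh => (c.pushesTo_iff hc hxc h p).trans ⟨fun h => h.2.2.symm,
    fun h => ⟨hH.subset _ x.2 hh, hp, h.symm⟩⟩

theorem IsHorizontal.existsUnique_lift {x : orthTTN T k} (hxc : x.1 ∈ c.dom)
    {p : TangentBundle 𝓘(ℝ, F) (TTNQuotient T k)} (hp : p.1 = quotMap T k x) :
    ∃! h : Param T k, IsHorizontalLift 𝓘(ℝ, F) H x p h := by
  simp only [hH.isHorizontalLift_iff hc hxc hp]
  obtain ⟨h, hh, hw⟩ := hH.exists_eq hc x.2 hxc (tcoord c.chart p)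
  refine ⟨h, ⟨hh, hw⟩, fun h' hh' => sub_eq_zero.1 ?_⟩
  refine hH.eq_zero hc x.2 hxc ((H x.1).sub_mem hh'.1 hh) ?_
  rw [map_sub, hh'.2, hw, sub_self]

/-- Over a neighbourhood of a point of the quotient, base points and horizontal lifts can be chosen
smoothly in the coordinates of a slice chart. -/
theorem IsHorizontal.exists_smooth_lift [CompleteSpace F] {x : orthTTN T k} (hxc : x.1 ∈ c.dom) :
    ∃ V : Set F, IsOpen V ∧ c.toFun x.1 ∈ V ∧ ∃ ψ : F × F → Param T k × Param T k,
      ContDiffOn ℝ ∞ ψ (V ×ˢ Set.univ) ∧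
      ∀ p : TangentBundle 𝓘(ℝ, F) (TTNQuotient T k), p.1 ∈ c.chart.source → c.chart p.1 ∈ V →
        ∃ y : orthTTN T k, (ψ (c.chart p.1, tcoord c.chart p)).1 = y ∧ p.1 = quotMap T k y ∧
          IsHorizontalLift 𝓘(ℝ, F) H y p (ψ (c.chart p.1, tcoord c.chart p)).2 := by
  obtain ⟨W, σ, hW, hxW, hσc, hσx, hσ⟩ := c.exists_section x hxc
  obtain ⟨U, hU, hxU, n, X, hX, hframe⟩ := hH.smooth x.1 x.2
  obtain ⟨V, hVW, hV, hxV, l, hl, hlift⟩ := c.exists_smooth_lift (H := H) hσc hW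
    (fun z hz => ⟨(hσ z hz).1, (hσ z hz).2.1⟩) (fun y hy hyc h hh h0 => hH.eq_zero hc hy hyc hh h0)
    (fun y hy hyc w => hH.exists_eq hc hy hyc w) hxW hU (by rwa [hσx]) hX hframe
  refine ⟨V, hV, hxV, fun q => (σ q.1, l q),
    (hσc.comp contDiff_fst.contDiffOn fun q hq => hVW hq.1).prodMk hl, fun p hp hpV => ?_⟩
  obtain ⟨hS, hdom, hz⟩ := hσ _ (hVW hpV)
  have hproj : p.1 = quotMap T k ⟨σ (c.chart p.1), hS⟩ := by
    have h3 := c.chart_symm_toFun (x := ⟨σ (c.chart p.1), hS⟩) hdom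
    rw [show c.toFun (σ (c.chart p.1)) = c.chart p.1 from hz, c.chart.left_inv hp] at h3
    exact h3
  exact ⟨⟨σ (c.chart p.1), hS⟩, rfl, hproj,
    (hH.isHorizontalLift_iff hc hdom hproj).2 (hlift _ hpV _)⟩

end Quotient

end Gauge

section Induced

variable {d : ℕ} {T : DimensionTree d} {k : Finset (Fin d) → ℕ}
  {F : Type*} [NormedAddCommGroup F] [NormedSpace ℝ F]
  [ChartedSpace F (TTNQuotient T k)] [IsManifold 𝓘(ℝ, F) ∞ (TTNQuotient T k)]
  {H : Param T k → Submodule ℝ (Param T k)} (hH : IsHorizontal 𝓘(ℝ, F) H)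
  {D : Set (Param T k × Param T k)} {R : Param T k → Param T k → Param T k}
  (hR : IsRetraction (orthTTN T k) D R)

variable (T k F) in
/-- Every point of the quotient lies in the domain of a chart that comes from a slice chart. -/
def HasSliceAtlas : Prop := ∀ x : orthTTN T k, ∃ c : SliceChart (orbitSetoid T k) F,
  x.1 ∈ c.dom ∧ c.chart ∈ atlas F (TTNQuotient T k)

variable (hat : HasSliceAtlas T k F)

include hH hat in
theorem IsHorizontal.isHorizontalLift_zero (x : orthTTN T k) :
    IsHorizontalLift 𝓘(ℝ, F) H x (⟨quotMap T k x, 0⟩ : TangentBundle _ _) 0 := by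
  obtain ⟨c, hxc, hc⟩ := hat x
  refine (hH.isHorizontalLift_iff hc hxc rfl).2 ⟨(H x.1).zero_mem, ?_⟩
  rw [tcoord_zero, map_zero]

include hH hat in
/-- Horizontal lifts of the same tangent vector at equivalent points are equivalent. -/
theorem IsHorizontal.exists_gauge_lift {x y : orthTTN T k}
    {p : TangentBundle 𝓘(ℝ, F) (TTNQuotient T k)} {h v : Param T k} (hp : p.1 = quotMap T k x)
    (hl : IsHorizontalLift 𝓘(ℝ, F) H x p h) (hpy : p.1 = quotMap T k y)
    (hly : IsHorizontalLift 𝓘(ℝ, F) H y p v) :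
    ∃ A : GaugeGroup T k, x.1 = gaugeAct y.1 A ∧ h = gaugeAct v A := by
  obtain ⟨A, hA⟩ := exists_gauge_of_quotMap_eq (hpy.symm.trans hp)
  have h3 := isHorizontalLift_gaugeAct hH hly A
  have h4 : (⟨gaugeAct y.1 A, gaugeAct_mem y.2 A⟩ : orthTTN T k) = x := Subtype.ext hA.symm
  rw [h4] at h3
  obtain ⟨c, hxc, hc⟩ := hat x
  exact ⟨A, hA, (hH.existsUnique_lift hc hxc hp).unique hl h3⟩

include hH hat in
/-- The value of the induced map at `p` does not depend on the representative. -/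
theorem IsHorizontal.exists_value
    (hRM : ∀ (x : Param T k) (h : Param T k), (x, h) ∈ D → R x h ∈ orthTTN T k)
    (hRA : ∀ p ∈ D, ∀ A : GaugeGroup T k,
      R (gaugeAct p.1 A) (gaugeAct p.2 A) = gaugeAct (R p.1 p.2) A)
    (p : TangentBundle 𝓘(ℝ, F) (TTNQuotient T k)) : ∃ q : TTNQuotient T k,
      ∀ (x : orthTTN T k) (h : Param T k), p.1 = quotMap T k x →
        IsHorizontalLift 𝓘(ℝ, F) H x p h → (x.1, h) ∈ D →
        ∃ hm : R x.1 h ∈ orthTTN T k, q = quotMap T k ⟨R x.1 h, hm⟩ := by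
  by_cases hex : ∃ (y : orthTTN T k) (v : Param T k), p.1 = quotMap T k y ∧
    IsHorizontalLift 𝓘(ℝ, F) H y p v ∧ (y.1, v) ∈ D
  · obtain ⟨y, v, hpy, hly, hyD⟩ := hex
    have hym := hRM y.1 v hyD
    refine ⟨quotMap T k ⟨R y.1 v, hym⟩, fun x h hp hl hxD => ⟨hRM x.1 h hxD, ?_⟩⟩
    obtain ⟨A, hA, hA'⟩ := hH.exists_gauge_lift hat hp hl hpy hly
    have h1 : R x.1 h = gaugeAct (R y.1 v) A := by
      rw [hA, hA']
      exact hRA (y.1, v) hyD A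
    rw [← quotMap_gaugeAct ⟨R y.1 v, hym⟩ A]
    exact congrArg (quotMap T k) (Subtype.ext h1.symm)
  · exact ⟨p.1, fun x h hp hl hxD => absurd ⟨x, h, hp, hl, hxD⟩ hex⟩

include hH hat in
/-- A gauge equivariant map into `𝒯` on a subset of the tangent bundle of `𝒯` induces a map on the
tangent bundle of the quotient. -/
theorem exists_isInducedMap
    (hRM : ∀ (x : Param T k) (h : Param T k), (x, h) ∈ D → R x h ∈ orthTTN T k)
    (hD : ∀ p ∈ D, ∀ A : GaugeGroup T k, (gaugeAct p.1 A, gaugeAct p.2 A) ∈ D)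
    (hRA : ∀ p ∈ D, ∀ A : GaugeGroup T k,
      R (gaugeAct p.1 A) (gaugeAct p.2 A) = gaugeAct (R p.1 p.2) A) :
    ∃ (Dq : Set (TangentBundle 𝓘(ℝ, F) (TTNQuotient T k)))
      (Rq : TangentBundle 𝓘(ℝ, F) (TTNQuotient T k) → TTNQuotient T k),
      IsInducedMap 𝓘(ℝ, F) H D R Dq Rq := by
  choose Rq hRq using hH.exists_value hat hRM hRA
  refine ⟨{p | ∃ (y : orthTTN T k) (v : Param T k), p.1 = quotMap T k y ∧
      IsHorizontalLift 𝓘(ℝ, F) H y p v ∧ (y.1, v) ∈ D}, Rq, fun x p hp => ⟨?_, fun h hl =>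
    ⟨⟨?_, fun hxD => ⟨x, h, hp, hl, hxD⟩⟩, hRq p x h hp hl⟩⟩⟩
  · obtain ⟨c, hxc, hc⟩ := hat x
    exact hH.existsUnique_lift hc hxc hp
  · rintro ⟨y, v, hpy, hly, hyD⟩
    obtain ⟨A, hA, rfl⟩ := hH.exists_gauge_lift hat hp hl hpy hly
    rw [hA]
    exact hD (y.1, v) hyD A

include hH in
/-- Around each tangent vector of the quotient, base points and horizontal lifts are a smooth
function `ψ` of the coordinates of the tangent vector. -/
theorem IsHorizontal.exists_smooth_lift_nhds [CompleteSpace F]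
    {c : SliceChart (orbitSetoid T k) F} (hc : c.chart ∈ atlas F (TTNQuotient T k))
    {x : orthTTN T k} (hxc : x.1 ∈ c.dom) {p : TangentBundle 𝓘(ℝ, F) (TTNQuotient T k)}
    (hp : p.1 = quotMap T k x) :
    ∃ O : Set (TangentBundle 𝓘(ℝ, F) (TTNQuotient T k)), IsOpen O ∧ p ∈ O ∧
    ∃ (V : Set F) (ψ : F × F → Param T k × Param T k), IsOpen V ∧
      ContDiffOn ℝ ∞ ψ (V ×ˢ Set.univ) ∧
      ContMDiffOn 𝓘(ℝ, F).tangent 𝓘(ℝ, F × F) ∞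
        (fun p : TangentBundle 𝓘(ℝ, F) (TTNQuotient T k) => (c.chart p.1, tcoord c.chart p)) O ∧
      Set.MapsTo (fun p : TangentBundle 𝓘(ℝ, F) (TTNQuotient T k) =>
        (c.chart p.1, tcoord c.chart p)) O (V ×ˢ Set.univ) ∧
      ∀ p ∈ O, ∃ y : orthTTN T k, (ψ (c.chart p.1, tcoord c.chart p)).1 = y ∧
        p.1 = quotMap T k y ∧
        IsHorizontalLift 𝓘(ℝ, F) H y p (ψ (c.chart p.1, tcoord c.chart p)).2 := by
  obtain ⟨V, hV, hxV, ψ, hψ, hlift⟩ := hH.exists_smooth_lift hc hxc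
  have h1 := contMDiffOn_chart_proj (F := F) hc
  have h2 := contMDiffOn_tcoord (F := F) hc
  refine ⟨{p | p.1 ∈ c.chart.source} ∩ (fun p => c.chart p.1) ⁻¹' V,
    h1.continuousOn.isOpen_inter_preimage (isOpen_proj_preimage_source c.chart) hV, ⟨?_, ?_⟩,
    V, ψ, hV, hψ, (h1.prodMk_space h2).mono Set.inter_subset_left, fun p hp => ⟨hp.2, trivial⟩,
    fun p hp => hlift p hp.1 hp.2⟩
  · rw [Set.mem_ofPred_eq, hp]
    exact c.mk_mem_source.2 hxc
  · rw [Set.mem_preimage, hp, show c.chart (quotMap T k x) = _ from c.chart_mk hxc]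
    exact hxV

variable {Dq : Set (TangentBundle 𝓘(ℝ, F) (TTNQuotient T k))}
  {Rq : TangentBundle 𝓘(ℝ, F) (TTNQuotient T k) → TTNQuotient T k}
  (hind : IsInducedMap 𝓘(ℝ, F) H D R Dq Rq)

include hH hR hat hind

theorem IsInducedMap.isOpen_domain [CompleteSpace F] : IsOpen Dq := by
  obtain ⟨U, hU, hDU⟩ := hR.isOpen_domain
  refine isOpen_iff_mem_nhds.2 fun p hpD => ?_
  obtain ⟨x, hx⟩ := Quotient.exists_rep p.1
  obtain ⟨c, hxc, hc⟩ := hat x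
  obtain ⟨O, hO, hpO, V, ψ, hV, hψ, hcoord, hmaps, hlift⟩ :=
    hH.exists_smooth_lift_nhds hc hxc hx.symm
  have hiff : ∀ p ∈ O, (p ∈ Dq ↔ ψ (c.chart p.1, tcoord c.chart p) ∈ U) := by
    intro p hp
    obtain ⟨y, hy1, hy2, hy3⟩ := hlift p hp
    rw [((hind y p hy2).2 _ hy3).1, ← hy1, hDU]
    exact ⟨fun h => h.2, fun h => ⟨by
      have := hy3.mem_tangentPairs hH
      rwa [← hy1] at this, h⟩⟩
  have hcont := hψ.continuousOn.comp hcoord.continuousOn hmaps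
  filter_upwards [(hcont.isOpen_inter_preimage hO hU).mem_nhds
    ⟨hpO, (hiff p hpO).1 hpD⟩] with p' hp'
  exact (hiff p' hp'.1).2 hp'.2

theorem IsInducedMap.contMDiffOn [CompleteSpace F] :
    ContMDiffOn 𝓘(ℝ, F).tangent 𝓘(ℝ, F) ∞ Rq Dq := by
  intro p hpD
  obtain ⟨x, hx⟩ := Quotient.exists_rep p.1
  obtain ⟨c, hxc, hc⟩ := hat x
  obtain ⟨O, hO, hpO, V, ψ, hV, hψ, hcoord, hmaps, hlift⟩ :=
    hH.exists_smooth_lift_nhds hc hxc hx.symm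
  set χ : TangentBundle 𝓘(ℝ, F) (TTNQuotient T k) → F × F :=
    fun p => (c.chart p.1, tcoord c.chart p)
  have hRq : ∀ p ∈ O, p ∈ Dq → ψ (χ p) ∈ D ∧
      ∃ hm : R (ψ (χ p)).1 (ψ (χ p)).2 ∈ orthTTN T k,
        Rq p = quotMap T k ⟨R (ψ (χ p)).1 (ψ (χ p)).2, hm⟩ := by
    intro p hp hpD
    obtain ⟨y, hy1, hy2, hy3⟩ := hlift p hp
    have h1 := (hind y p hy2).2 _ hy3
    rw [← hy1] at h1
    exact ⟨h1.1.1 hpD, h1.2 (h1.1.1 hpD)⟩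
  obtain ⟨hψD, hm, -⟩ := hRq p hpO hpD
  obtain ⟨V', hV', hpV', g, hg, hRg⟩ := hR.smooth _ hψD
  obtain ⟨c', hxc', hc'⟩ := hat ⟨_, hm⟩
  have hgp : g (ψ (χ p)) = R (ψ (χ p)).1 (ψ (χ p)).2 := (hRg ⟨hpV', hψD⟩).symm
  have hχp : ContMDiffAt 𝓘(ℝ, F).tangent 𝓘(ℝ, F × F) ∞ χ p := hcoord.contMDiffAt (hO.mem_nhds hpO)
  have hψp : ContDiffAt ℝ ∞ ψ (χ p) :=
    hψ.contDiffAt ((hV.prod isOpen_univ).mem_nhds (hmaps hpO))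
  have hgψ : ContDiffAt ℝ ∞ (g ∘ ψ) (χ p) :=
    ContDiffAt.comp _ (hg.contDiffAt (hV'.mem_nhds hpV')) hψp
  have hfψ : ContDiffAt ℝ ∞ (c'.toFun ∘ (g ∘ ψ)) (χ p) := by
    refine ContDiffAt.comp _ ?_ hgψ
    rw [Function.comp_apply, hgp]
    exact c'.contDiffOn_toFun.contDiffAt (c'.isOpen_dom.mem_nhds hxc')
  have hsymm : ContMDiffOn 𝓘(ℝ, F) 𝓘(ℝ, F) ∞ c'.chart.symm c'.chart.target :=
    contMDiffOn_symm_of_mem_maximalAtlas (IsManifold.subset_maximalAtlas hc')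
  have h3 : ContMDiffAt 𝓘(ℝ, F).tangent 𝓘(ℝ, F) ∞
      (c'.chart.symm ∘ ((c'.toFun ∘ (g ∘ ψ)) ∘ χ)) p := by
    refine ContMDiffAt.comp p (hsymm.contMDiffAt (c'.chart.open_target.mem_nhds ?_))
      (hfψ.contMDiffAt.comp p hχp)
    simp only [Function.comp_apply]
    rw [hgp]
    exact c'.toFun_mem_target hxc'
  have h4 : ∀ p' ∈ Dq, p' ∈ O → ψ (χ p') ∈ V' → g (ψ (χ p')) ∈ c'.dom →
      Rq p' = (c'.chart.symm ∘ ((c'.toFun ∘ (g ∘ ψ)) ∘ χ)) p' := by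
    intro p' hpD hpO hpV hpU
    obtain ⟨hψD, hm, h5⟩ := hRq p' hpO hpD
    have h6 : R (ψ (χ p')).1 (ψ (χ p')).2 = g (ψ (χ p')) := hRg ⟨hpV, hψD⟩
    have hpR : R (ψ (χ p')).1 (ψ (χ p')).2 ∈ c'.dom := by
      rw [h6]
      exact hpU
    rw [h5]
    simp only [Function.comp_apply]
    rw [← h6]
    exact (c'.chart_symm_toFun (x := ⟨_, hm⟩) hpR).symm
  have e1 : ∀ᶠ p' in 𝓝 p, ψ (χ p') ∈ V' :=
    (hψp.continuousAt.comp hχp.continuousAt).eventually (hV'.mem_nhds hpV')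
  have e2 : ∀ᶠ p' in 𝓝 p, g (ψ (χ p')) ∈ c'.dom :=
    (hgψ.continuousAt.comp hχp.continuousAt).eventually (c'.isOpen_dom.mem_nhds (by
      simp only [Function.comp_apply]
      rw [hgp]
      exact hxc'))
  refine h3.contMDiffWithinAt.congr_of_eventuallyEq ?_
    (h4 p hpD hpO hpV' (by rw [hgp]; exact hxc'))
  filter_upwards [self_mem_nhdsWithin, nhdsWithin_le_nhds (hO.mem_nhds hpO),
    nhdsWithin_le_nhds e1, nhdsWithin_le_nhds e2] with p' a1 a2 a3 a4 using h4 p' a1 a2 a3 a4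

theorem IsInducedMap.map_zero (x : orthTTN T k) :
    Rq (⟨quotMap T k x, 0⟩ : TangentBundle _ _) = quotMap T k x := by
  obtain ⟨h1, h2⟩ := ((hind x (⟨quotMap T k x, 0⟩ : TangentBundle _ _) rfl).2 0
    (hH.isHorizontalLift_zero hat x)).2 (hR.zero_mem _ x.2)
  rw [h2]
  exact congrArg _ (Subtype.ext (hR.map_zero _ x.2))

theorem IsInducedMap.velocity (q : TTNQuotient T k) (w : TangentSpace 𝓘(ℝ, F) q) :
    HasVelocity 𝓘(ℝ, F) (fun s : ℝ => Rq ⟨q, s • w⟩) ⟨q, w⟩ := by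
  obtain ⟨U, hU, hDU⟩ := hR.isOpen_domain
  obtain ⟨x, rfl⟩ := Quotient.exists_rep q
  obtain ⟨c, hxc, hc⟩ := hat x
  obtain ⟨h, hl, -⟩ := hH.existsUnique_lift hc hxc
    (p := (⟨quotMap T k x, w⟩ : TangentBundle _ _)) rfl
  have hlw := (hH.isHorizontalLift_iff hc hxc rfl).1 hl
  have hls : ∀ s : ℝ, IsHorizontalLift 𝓘(ℝ, F) H x
      (⟨quotMap T k x, s • w⟩ : TangentBundle _ _) (s • h) := by
    intro s
    refine (hH.isHorizontalLift_iff hc hxc rfl).2 ⟨(H x.1).smul_mem s hlw.1, ?_⟩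
    rw [map_smul, hlw.2]
    exact (tcoord_smul _ _ s w).symm
  have hd := hR.velocity (x.1, h) (hl.mem_tangentPairs hH)
  have hd0 : R x.1 ((0 : ℝ) • h) = x.1 := by
    rw [zero_smul]
    exact hR.map_zero _ x.2
  have hcd : HasFDerivAt c.toFun (fderiv ℝ c.toFun x.1) (R x.1 ((0 : ℝ) • h)) := by
    rw [hd0]
    exact ((c.contDiffOn_toFun.contDiffAt (c.isOpen_dom.mem_nhds hxc)).differentiableAt
      (by simp)).hasFDerivAt
  refine (hasVelocity_iff hc (f := fun s : ℝ => c.toFun (R x.1 (s • h))) ?_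
    (hcd.comp_hasDerivAt 0 hd) _).2 ⟨?_, hlw.2.symm⟩
  · have e1 : ∀ᶠ s : ℝ in 𝓝 0, (x.1, s • h) ∈ U := by
      have hcs : Continuous fun s : ℝ => (x.1, s • h) :=
        continuous_const.prodMk (continuous_id.smul continuous_const)
      refine hcs.continuousAt.eventually (hU.mem_nhds ?_)
      simp only [zero_smul]
      exact (hDU ▸ hR.zero_mem _ x.2 : (x.1, (0 : Param T k)) ∈ _ ∩ U).2
    have e2 : ∀ᶠ s : ℝ in 𝓝 0, R x.1 (s • h) ∈ c.dom :=
      hd.continuousAt.eventually (c.isOpen_dom.mem_nhds (by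
        simp only [hd0]
        exact hxc))
    filter_upwards [e1, e2] with s hs1 hs2
    obtain ⟨hm, h5⟩ := ((hind x _ rfl).2 _ (hls s)).2 (by
      rw [hDU]
      exact ⟨(hls s).mem_tangentPairs hH, hs1⟩)
    change Rq ⟨quotMap T k x, s • w⟩ ∈ _ ∧ c.chart (Rq ⟨quotMap T k x, s • w⟩) = _
    rw [h5]
    exact ⟨c.mk_mem_source.2 hs2, c.chart_mk (x := ⟨_, hm⟩) hs2⟩
  · rw [zero_smul]
    exact (hind.map_zero hH hR hat x).symm

/-- The map that a retraction on `𝒯` induces through horizontal lifts is a retraction. -/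
theorem IsInducedMap.isManifoldRetraction [CompleteSpace F] :
    IsManifoldRetraction 𝓘(ℝ, F) Dq Rq := by
  refine ⟨hind.isOpen_domain hH hR hat, fun q => ?_, hind.contMDiffOn hH hR hat, fun q => ?_,
    hind.velocity hH hR hat⟩
  · obtain ⟨x, rfl⟩ := Quotient.exists_rep q
    exact ((hind x (⟨quotMap T k x, 0⟩ : TangentBundle _ _) rfl).2 0
      (hH.isHorizontalLift_zero hat x)).1.2 (hR.zero_mem _ x.2)
  · obtain ⟨x, rfl⟩ := Quotient.exists_rep q
    exact hind.map_zero hH hR hat x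

end Induced

end TTN

theorem theorem4p2 {d : ℕ} (T : DimensionTree d) (k : Finset (Fin d) → ℕ)
    (hk : ∀ t ∈ T.nodes, 0 < k t) :
    (∀ (D : NodeDomains T k) (R : NodeMaps T k), AreStiefelRetractions D R →
      IsRetraction (orthTTN T k) (cartesianDomain D R) (cartesianRetraction R)) ∧
    (∃ (m : ℕ) (_ : ChartedSpace (EuclideanSpace ℝ (Fin m)) (TTNQuotient T k))
      (_ : IsManifold (𝓡 m) ∞ (TTNQuotient T k)),
      IsSmoothSubmersion (𝓡 m) (quotMap T k) ∧
      ∀ H : Param T k → Submodule ℝ (Param T k), IsHorizontal (𝓡 m) H →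
      ∀ (D : NodeDomains T k) (R : NodeMaps T k), AreStiefelRetractions D R →
        (∀ t : T.NonRoot, IsOrthogonallyEquivariant (D t) (R t)) →
        ∃ (Dq : Set (TangentBundle (𝓡 m) (TTNQuotient T k)))
          (Rq : TangentBundle (𝓡 m) (TTNQuotient T k) → TTNQuotient T k),
          IsInducedMap (𝓡 m) H (cartesianDomain D R) (cartesianRetraction R) Dq Rq ∧
          IsManifoldRetraction (𝓡 m) Dq Rq) ∧
    (∀ n m : ℕ,
      IsOrthogonallyEquivariant (tangentPairs (stiefel (Fin n) (Fin m))) polarMap ∧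
      IsOrthogonallyEquivariant (tangentPairs (stiefel (Fin n) (Fin m))) cayleyMap) := by
  refine ⟨fun D R hR => isRetraction_cartesianRetraction hR, ?_, fun n m => ⟨?_, ?_⟩⟩
  · choose c hc using fun x : orthTTN T k => exists_sliceChart x
    let _ := SliceChart.chartedSpace c hc
    have hM : IsManifold (𝓡 (quotDim T k)) ∞ (TTNQuotient T k) := SliceChart.isManifold c hc
    have hat : HasSliceAtlas T k (EuclideanSpace ℝ (Fin (quotDim T k))) :=
      fun x => ⟨c x, hc x, x, rfl⟩
    refine ⟨quotDim T k, inferInstance, hM, SliceChart.isSmoothSubmersion_mk hat,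
      fun H hH D R hR hE => ?_⟩
    have hret := isRetraction_cartesianRetraction hR
    obtain ⟨Dq, Rq, hind⟩ := exists_isInducedMap hH hat
      (fun x h hp => hret.mapsTo (x, h) hp)
      (fun p hp A => gaugeAct_mem_cartesianDomain hE hp A)
      (fun p hp A => cartesianRetraction_gaugeAct hE hp.2.1 A)
    exact ⟨Dq, Rq, hind, hind.isManifoldRetraction hH hret hat⟩
  · exact fun Q hQ W hW X V h => ⟨mul_mul_mem_tangentPairs hQ hW h, polarMap_equivariant hQ hW X V⟩
  · exact fun Q hQ W hW X V h => ⟨mul_mul_mem_tangentPairs hQ hW h, cayleyMap_equivariant hQ hW X V⟩
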